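/- Let $\phi:\mathbb R\to\mathbb R$ be a smooth function of compact support contained in $\mathbb R_{>0}$, let $\tilde\phi(s):=\int_0^\infty\phi(x)x^{s-1}\,dx$ be its Mellin transform, and for $x>0$ and $\gamma\in\mathbb C$ with $|\Re(\gamma)|<1$ let $$F_\gamma(x):=\frac1{2\pi i}\int_{2-i\infty}^{2+i\infty}\tilde\phi(s-\gamma)\,x^{s-\gamma-1}\,\zeta(s+\gamma)\,\zeta(s-\gamma)\,ds .$$ Let $\vartheta>0$ be fixed and let $A(s)=\sum_{n\le N}a_nn^{-s}$ be a Dirichlet polynomial with complex coefficients, of length $N\le T^\vartheta$, such that $a_n\ll_\eta n^\eta$ for every $\eta>0$. Then for all $\alpha,\beta\in\mathbb C$ with $\alpha,\beta\ll\frac1{\log T}$ and every $\varepsilon>0$, as $T\to\infty$, $$\int_{\mathbb R}A(\tfrac12+it)\,\zeta(\tfrac12+it+\alpha)\,\zeta(\tfrac12-it+\beta)\,\phi\Big(\frac tT\Big)\,dt=T\sum_{n\le N}\frac{a_n}{n^{1+\beta}}\,F_{\frac{\alpha+\beta}2}\Big(\frac T{2\pi n}\Big)+O\big(T^{\frac12+\varepsilon}\big).$$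 The implied constant depends only on $\varepsilon$, $\phi$, $\vartheta$ and the implied constants in the hypotheses on $a_n$, $\alpha$ and $\beta$; the coefficients $a_n$, the length $N$ and the shifts $\alpha,\beta$ may depend on $T$. -/

import Mathlib

namespace TwistedMoment

/-- The integral `∫_{(c)} G(s) ds = ∫_{c - i∞}^{c + i∞} G(s) ds` along the vertical line
`Re s = c`, parametrized by `s = c + i y`, `ds = i dy`. -/
noncomputable def verticalIntegral (c : ℝ) (G : ℂ → ℂ) : ℂ :=
  Complex.I * ∫ y : ℝ, G ((c : ℂ) + (y : ℂ) * Complex.I)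

/-- The Mellin transform `φ̃(s) = ∫_0^∞ φ(x) x^{s-1} dx` of a real-valued function. -/
noncomputable def mellinTransform (φ : ℝ → ℝ) (s : ℂ) : ℂ :=
  mellin (fun x : ℝ => (φ x : ℂ)) s

/-- `F_γ(x) = (1 / 2πi) ∫_{(2)} φ̃(s - γ) x^{s - γ - 1} ζ(s + γ) ζ(s - γ) ds`,
meaningful for `x > 0` and `|Re γ| < 1`. -/
noncomputable def kernelF (φ : ℝ → ℝ) (γ : ℂ) (x : ℝ) : ℂ :=
  (1 / (2 * (Real.pi : ℂ) * Complex.I)) *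
    verticalIntegral 2 (fun s : ℂ =>
      mellinTransform φ (s - γ) * (x : ℂ) ^ (s - γ - 1) *
        riemannZeta (s + γ) * riemannZeta (s - γ))

/-- The Dirichlet polynomial `A(s) = ∑_{1 ≤ n ≤ N} a_n n^{-s}`. -/
noncomputable def dirichletPoly (N : ℕ) (a : ℕ → ℂ) (s : ℂ) : ℂ :=
  ∑ n ∈ Finset.Icc 1 N, a n * (n : ℂ) ^ (-s)

end TwistedMoment

/-! The mechanism is Poisson summation in the variable of the second zeta factor, with no functional
equation and no contour shift. Since `φ(t/T)` confines `t` to an interval of size `T` away from `0`,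
both zeta factors may be replaced, up to a negative power of `T` as large as desired, by Dirichlet
polynomials with a smooth weight (`exists_smooth_zeta_approx`). Averaging the Euler–Maclaurin
truncation over its length turns the pole term into a rapidly decaying transform.

After expanding `A` and the first zeta polynomial, each pair `(n, k)` contributes one frequency `q =
nk`, and it remains to integrate `φ(t/T) q^{-1/2-it} l^{-1/2+it-β}` and sum over `l`. The
`t`-integral is negligible unless `l` is within a constant factor of `q`, so the weight may be
exchanged for a cutoff in `log (l/q)`. Poisson summation in `l` then gives `q^{-β} ∑_j dualTerm
(jq)`. In `dualTerm` the `t`-average forces `v` to have size `1/T`. There `e(-m e^v)` is close to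
`e(-m v)`, because `e(-m) = 1` for an integer `m`, and Fourier inversion gives `2π φ(2πm/T)`
(`exists_norm_dualTerm_sub_le`).

The error is `O(1/T + |m|/T²)`, and integration by parts gives rapid decay once `|m|` exceeds `T` by
a small power. Together these are dominated by `T^{1/2+δ} |m|^{-3/2}`
(`exists_norm_dualTerm_sub_le_rpow`), which at `m = nkj` is summable over all three variables
separately. The total is therefore independent of the lengths of the polynomials.

On the other side, Mellin inversion turns the main term at `n` into `2π n^{-β} ∑_{k,j} k^{-α-β}
φ(2πnkj/T)` (`kernelF_eq_tsum`, `kernelF_mul_eq_sum`). This is what the dual sums produce, the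
factors `k^{-α}` and `(nk)^{-β}` coming from the two shifts. -/

namespace TwistedMoment

open Complex MeasureTheory Filter Topology Set
open scoped ContDiff SchwartzMap FourierTransform

/-! ### Oscillatory integrals with exponential phase. -/

/-- The oscillatory integral `∫ ψ(v) e^{cv} e(-m e^v) dv`. -/
noncomputable def oscIntegral (ψ : ℝ → ℂ) (c : ℂ) (m : ℝ) : ℂ :=
  ∫ v : ℝ, ψ v * cexp (c * v) * cexp (-(2 * Real.pi * m * Real.exp v : ℝ) * I)

lemma norm_cexp_neg_ofReal_mul_I (x : ℝ) : ‖cexp (-(x : ℂ) * I)‖ = 1 := by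
  have := Complex.norm_exp_ofReal_mul_I (-x)
  simpa using this

lemma continuous_oscIntegrand {ψ : ℝ → ℂ} (hψ : Continuous ψ) (c : ℂ) (m : ℝ) :
    Continuous fun v : ℝ => ψ v * cexp (c * v) *
      cexp (-(2 * Real.pi * m * Real.exp v : ℝ) * I) := by
  fun_prop

lemma integrable_oscIntegrand {ψ : ℝ → ℂ} (hψ : Continuous ψ) (hc : HasCompactSupport ψ)
    (c : ℂ) (m : ℝ) :
    Integrable fun v : ℝ => ψ v * cexp (c * v) *
      cexp (-(2 * Real.pi * m * Real.exp v : ℝ) * I) :=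
  (continuous_oscIntegrand hψ c m).integrable_of_hasCompactSupport
    (HasCompactSupport.mul_right (HasCompactSupport.mul_right hc))

lemma exists_norm_oscIntegral_le {ψ : ℝ → ℂ} (hψ : Continuous ψ) (hc : HasCompactSupport ψ)
    (R : ℝ) : ∃ C, ∀ c : ℂ, |c.re| ≤ R → ∀ m : ℝ, ‖oscIntegral ψ c m‖ ≤ C := by
  refine ⟨∫ v : ℝ, ‖ψ v‖ * Real.exp (R * |v|), fun c hcR m => ?_⟩
  refine norm_integral_le_of_norm_le ?_ (Eventually.of_forall fun v => ?_)
  · exact (by fun_prop : Continuous fun v : ℝ => ‖ψ v‖ * Real.exp (R * |v|))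
      |>.integrable_of_hasCompactSupport hc.norm.mul_right
  · rw [norm_mul, norm_mul, norm_cexp_neg_ofReal_mul_I, mul_one, Complex.norm_exp]
    gcongr
    simp only [mul_re, ofReal_re, ofReal_im, mul_zero, sub_zero]
    calc c.re * v ≤ |c.re * v| := le_abs_self _
      _ = |c.re| * |v| := abs_mul _ _
      _ ≤ R * |v| := by gcongr

lemma hasDerivAt_oscPhase (m v : ℝ) :
    HasDerivAt (fun v : ℝ => cexp (-(2 * Real.pi * m * Real.exp v : ℝ) * I))
      (-(2 * Real.pi * m * Real.exp v : ℝ) * I *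
        cexp (-(2 * Real.pi * m * Real.exp v : ℝ) * I)) v := by
  have h1 : HasDerivAt (fun v : ℝ => 2 * Real.pi * m * Real.exp v)
      (2 * Real.pi * m * Real.exp v) v := (Real.hasDerivAt_exp v).const_mul _
  have h2 := (h1.ofReal_comp.fun_neg.mul_const I).cexp
  rwa [mul_comm (cexp _)] at h2

lemma hasDerivAt_cexp_mul (c : ℂ) (v : ℝ) :
    HasDerivAt (fun v : ℝ => cexp (c * v)) (c * cexp (c * v)) v := by
  have h2 := ((Complex.ofRealCLM.hasDerivAt (x := v)).const_mul c).cexp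
  rw [mul_comm]
  simpa using h2

lemma oscIntegral_zero_ibp {ψ : ℝ → ℂ} (hψ : ContDiff ℝ ∞ ψ) (hc : HasCompactSupport ψ) (c : ℂ) :
    c * oscIntegral ψ c 0 = -oscIntegral (deriv ψ) c 0 := by
  have hd : Continuous (deriv ψ) := hψ.continuous_deriv (by simp)
  have key := integral_mul_deriv_eq_deriv_mul_of_integrable (u := ψ) (u' := deriv ψ)
    (v := fun v : ℝ => cexp (c * v)) (v' := fun v : ℝ => c * cexp (c * v))
    (fun v _ => (hψ.differentiable (by simp) v).hasDerivAt) (fun v _ => hasDerivAt_cexp_mul c v)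
    ((by fun_prop : Continuous (ψ * fun v : ℝ => c * cexp (c * v)))
      |>.integrable_of_hasCompactSupport hc.mul_right)
    ((by fun_prop : Continuous (deriv ψ * fun v : ℝ => cexp (c * v)))
      |>.integrable_of_hasCompactSupport hc.deriv.mul_right)
    ((by fun_prop : Continuous (ψ * fun v : ℝ => cexp (c * v)))
      |>.integrable_of_hasCompactSupport hc.mul_right)
  simp only [oscIntegral, mul_zero, zero_mul, ofReal_zero, neg_zero, Complex.exp_zero, mul_one]
  rw [← key, ← integral_const_mul]
  congr 1; ext v; ring

/-- The derivative of the phase carries a factor `e^v`, which is borrowed from `e^{cv}`. Hence `c`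
drops to `c - 1`, and iterating the identity widens the vertical strip by one each time. -/
lemma oscIntegral_ibp {ψ : ℝ → ℂ} (hψ : ContDiff ℝ ∞ ψ) (hc : HasCompactSupport ψ) (c : ℂ)
    (m : ℝ) :
    (2 * Real.pi * m * I) * oscIntegral ψ c m =
      oscIntegral (deriv ψ) (c - 1) m + (c - 1) * oscIntegral ψ (c - 1) m := by
  have hd : Continuous (deriv ψ) := hψ.continuous_deriv (by simp)
  have key := integral_mul_deriv_eq_deriv_mul_of_integrable
    (u := fun v : ℝ => ψ v * cexp ((c - 1) * v))
    (u' := fun v : ℝ => deriv ψ v * cexp ((c - 1) * v) + ψ v * ((c - 1) * cexp ((c - 1) * v)))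
    (v := fun v : ℝ => cexp (-(2 * Real.pi * m * Real.exp v : ℝ) * I))
    (v' := fun v : ℝ => -(2 * Real.pi * m * Real.exp v : ℝ) * I *
        cexp (-(2 * Real.pi * m * Real.exp v : ℝ) * I))
    (fun v _ => (hψ.differentiable (by simp) v).hasDerivAt.fun_mul (hasDerivAt_cexp_mul (c - 1) v))
    (fun v _ => hasDerivAt_oscPhase m v)
    (Continuous.integrable_of_hasCompactSupport (by fun_prop) hc.mul_right.mul_right)
    (Continuous.integrable_of_hasCompactSupport (by fun_prop)
      (hc.deriv.mul_right.add hc.mul_right).mul_right)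
    (Continuous.integrable_of_hasCompactSupport (by fun_prop) hc.mul_right.mul_right)
  simp only [oscIntegral]
  rw [← integral_const_mul, ← integral_const_mul,
    ← integral_add (integrable_oscIntegrand hd hc.deriv (c - 1) m)
      ((integrable_oscIntegrand hψ.continuous hc (c - 1) m).const_mul _)]
  rw [← neg_eq_iff_eq_neg, ← integral_neg] at key
  convert key using 1
  · congr 1; ext v
    have : cexp (c * v) = cexp ((c - 1) * v) * cexp v := by rw [← Complex.exp_add]; congr 1; ring
    rw [this]
    push_cast
    ring
  · congr 1; ext v; ring

/-- Rapid decay in `c` of `∫ ψ(v) e^{cv} dv` in vertical strips. -/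
lemma exists_norm_oscIntegral_zero_mul_pow_le {ψ : ℝ → ℂ} (hψ : ContDiff ℝ ∞ ψ)
    (hc : HasCompactSupport ψ) (R : ℝ) (K : ℕ) :
    ∃ C, ∀ c : ℂ, |c.re| ≤ R → ‖oscIntegral ψ c 0‖ * ‖c‖ ^ K ≤ C := by
  induction K generalizing ψ with
  | zero =>
    obtain ⟨C, hC⟩ := exists_norm_oscIntegral_le hψ.continuous hc R
    exact ⟨C, fun c h => by simpa using hC c h 0⟩
  | succ K ih =>
    obtain ⟨C, hC⟩ := ih (ψ := deriv ψ) (contDiff_infty_iff_deriv.mp hψ).2 hc.deriv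
    refine ⟨C, fun c h => ?_⟩
    have := hC c h
    rw [← norm_neg, ← oscIntegral_zero_ibp hψ hc, norm_mul] at this
    rw [pow_succ']
    linarith

/-- Rapid decay in `m` of the oscillatory integral, polynomially in `c`. -/
lemma exists_norm_oscIntegral_mul_pow_le {ψ : ℝ → ℂ} (hψ : ContDiff ℝ ∞ ψ)
    (hc : HasCompactSupport ψ) (R : ℝ) (K : ℕ) :
    ∃ C, 0 ≤ C ∧ ∀ c : ℂ, |c.re| ≤ R → ∀ m : ℝ,
      ‖oscIntegral ψ c m‖ * |m| ^ K ≤ C * (1 + ‖c‖) ^ K := by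
  induction K generalizing ψ R with
  | zero =>
    obtain ⟨C, hC⟩ := exists_norm_oscIntegral_le hψ.continuous hc R
    exact ⟨max C 0, le_max_right _ _, fun c h m => by simpa using Or.inl (hC c h m)⟩
  | succ K ih =>
    obtain ⟨C₁, h₁, hC₁⟩ := ih (ψ := deriv ψ) (contDiff_infty_iff_deriv.mp hψ).2 hc.deriv (R + 1)
    obtain ⟨C₂, h₂, hC₂⟩ := ih hψ hc (R + 1)
    refine ⟨(C₁ + C₂) * 2 ^ K, by positivity, fun c h m => ?_⟩
    have hre : |(c - 1).re| ≤ R + 1 := by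
      rw [sub_re, one_re]
      calc |c.re - 1| ≤ |c.re| + |1| := abs_sub _ _
        _ ≤ R + 1 := by simpa using h
    have hA := hC₁ (c - 1) hre m
    have hB := hC₂ (c - 1) hre m
    have hn : ‖c - 1‖ ≤ 1 + ‖c‖ := by
      calc ‖c - 1‖ ≤ ‖c‖ + ‖(1 : ℂ)‖ := norm_sub_le _ _
        _ = 1 + ‖c‖ := by rw [norm_one, add_comm]
    have hp : (1 + ‖c - 1‖) ^ K ≤ 2 ^ K * (1 + ‖c‖) ^ K := by
      rw [← mul_pow]
      gcongr
      linarith [norm_nonneg c]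
    have hibp : |m| * ‖oscIntegral ψ c m‖ ≤
        ‖oscIntegral (deriv ψ) (c - 1) m‖ + ‖c - 1‖ * ‖oscIntegral ψ (c - 1) m‖ := by
      rw [← norm_mul (c - 1)]
      refine le_trans ?_ (norm_add_le _ _)
      rw [← oscIntegral_ibp hψ hc, norm_mul]
      gcongr
      simp only [norm_mul, norm_I, mul_one, Complex.norm_real, Real.norm_eq_abs, RCLike.norm_ofNat,
        abs_of_pos Real.pi_pos]
      nlinarith [abs_nonneg m, Real.pi_gt_three]
    calc ‖oscIntegral ψ c m‖ * |m| ^ (K + 1)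
        = (|m| * ‖oscIntegral ψ c m‖) * |m| ^ K := by ring
      _ ≤ (‖oscIntegral (deriv ψ) (c - 1) m‖ + ‖c - 1‖ * ‖oscIntegral ψ (c - 1) m‖) * |m| ^ K := by
          gcongr
      _ = ‖oscIntegral (deriv ψ) (c - 1) m‖ * |m| ^ K +
          ‖c - 1‖ * (‖oscIntegral ψ (c - 1) m‖ * |m| ^ K) := by ring
      _ ≤ C₁ * (1 + ‖c - 1‖) ^ K + (1 + ‖c‖) * (C₂ * (1 + ‖c - 1‖) ^ K) := by gcongr
      _ ≤ (1 + ‖c‖) * (C₁ * (1 + ‖c - 1‖) ^ K) + (1 + ‖c‖) * (C₂ * (1 + ‖c - 1‖) ^ K) := by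
          have h0 : 0 ≤ C₁ * (1 + ‖c - 1‖) ^ K := by positivity
          nlinarith [mul_nonneg (norm_nonneg c) h0]
      _ = (1 + ‖c‖) * (C₁ + C₂) * (1 + ‖c - 1‖) ^ K := by ring
      _ ≤ (1 + ‖c‖) * (C₁ + C₂) * (2 ^ K * (1 + ‖c‖) ^ K) := by gcongr
      _ = (C₁ + C₂) * 2 ^ K * (1 + ‖c‖) ^ (K + 1) := by ring

/-! ### Truncation of the zeta function to the right of `Re s = 0`. -/

/-- The `k`-th Euler–Maclaurin term of `(s - 1) ζ(s)`. -/
noncomputable def zetaTerm (k : ℕ) (s : ℂ) : ℂ :=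
  (s - 1) * ((k + 1 : ℕ) : ℂ) ^ (-s) + ((k + 2 : ℕ) : ℂ) ^ (1 - s) - ((k + 1 : ℕ) : ℂ) ^ (1 - s)

lemma hasDerivAt_ofReal_cpow_pos (c : ℂ) {x : ℝ} (hx : 0 < x) :
    HasDerivAt (fun y : ℝ => (y : ℂ) ^ c) (c * (x : ℂ) ^ (c - 1)) x := by
  have h := (hasDerivAt_id (x : ℂ)).cpow_const (c := c) (Or.inl (by simpa using hx))
  simpa using h.comp_ofReal

lemma norm_cpow_sub_cpow_le (c : ℂ) {a b : ℝ} (ha : 0 < a) (hab : a ≤ b) (hc : c.re ≤ 1) :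
    ‖(b : ℂ) ^ c - (a : ℂ) ^ c‖ ≤ ‖c‖ * a ^ (c.re - 1) * (b - a) := by
  have := Convex.norm_image_sub_le_of_norm_hasDerivWithin_le
    (f := fun y : ℝ => (y : ℂ) ^ c) (f' := fun x => c * (x : ℂ) ^ (c - 1))
    (C := ‖c‖ * a ^ (c.re - 1)) (s := Icc a b) (x := a) (y := b)
    (fun x hx => (hasDerivAt_ofReal_cpow_pos c (ha.trans_le hx.1)).hasDerivWithinAt)
    (fun x hx => by
      rw [norm_mul, norm_cpow_eq_rpow_re_of_pos (ha.trans_le hx.1), sub_re, one_re]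
      gcongr ?_ * ?_
      exact Real.rpow_le_rpow_of_nonpos ha hx.1 (by linarith))
    (convex_Icc a b) (left_mem_Icc.mpr hab) (right_mem_Icc.mpr hab)
  rwa [Real.norm_of_nonneg (sub_nonneg.mpr hab)] at this

/-- With `a = k + 1`, the term is the increment over `[a, a + 1]` of `(s-1) a^{-s} y + y^{1-s}`. The
derivative of this function vanishes at `y = a`, so a second mean value estimate saves a full power
of `a`. -/
lemma norm_zetaTerm_le (k : ℕ) {s : ℂ} (hs : 0 ≤ s.re) :
    ‖zetaTerm k s‖ ≤ ‖s - 1‖ * ‖s‖ * ((k + 1 : ℕ) : ℝ) ^ (-s.re - 1) := by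
  set a : ℝ := ((k + 1 : ℕ) : ℝ) with ha
  have ha0 : 0 < a := by positivity
  have hmain := Convex.norm_image_sub_le_of_norm_hasDerivWithin_le
    (f := fun y : ℝ => (s - 1) * (a : ℂ) ^ (-s) * (y : ℂ) + (y : ℂ) ^ (1 - s))
    (f' := fun x => (s - 1) * (a : ℂ) ^ (-s) + (1 - s) * (x : ℂ) ^ (1 - s - 1))
    (C := ‖s - 1‖ * ‖s‖ * a ^ (-s.re - 1)) (s := Icc a (a + 1)) (x := a) (y := a + 1)
    (fun x hx => by
      have h1 := (hasDerivAt_ofReal_cpow_pos (1 - s) (ha0.trans_le hx.1))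
      have h2 : HasDerivAt (fun y : ℝ => (s - 1) * (a : ℂ) ^ (-s) * (y : ℂ))
          ((s - 1) * (a : ℂ) ^ (-s)) x := by
        simpa using (Complex.ofRealCLM.hasDerivAt (x := x)).const_mul ((s - 1) * (a : ℂ) ^ (-s))
      exact (h2.fun_add h1).hasDerivWithinAt)
    (fun x hx => by
      have : (s - 1) * (a : ℂ) ^ (-s) + (1 - s) * (x : ℂ) ^ (1 - s - 1) =
          -((s - 1) * ((x : ℂ) ^ (-s) - (a : ℂ) ^ (-s))) := by
        rw [show 1 - s - 1 = -s by ring]; ring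
      rw [this, norm_neg, norm_mul, mul_assoc]
      gcongr
      refine (norm_cpow_sub_cpow_le (-s) ha0 hx.1 (by simp; linarith)).trans ?_
      rw [norm_neg, neg_re]
      refine mul_le_of_le_one_right (by positivity) (by linarith [hx.2]))
    (convex_Icc a (a + 1)) (left_mem_Icc.mpr (by linarith)) (right_mem_Icc.mpr (by linarith))
  have he : zetaTerm k s = ((s - 1) * (a : ℂ) ^ (-s) * ((a + 1 : ℝ) : ℂ) +
      ((a + 1 : ℝ) : ℂ) ^ (1 - s)) - ((s - 1) * (a : ℂ) ^ (-s) * (a : ℂ) + (a : ℂ) ^ (1 - s)) := by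
    simp only [zetaTerm, ha]
    push_cast
    rw [show (k : ℂ) + 1 + 1 = k + 2 by ring]
    ring
  rw [he]
  simpa using hmain

lemma sum_range_zetaTerm (N : ℕ) (s : ℂ) :
    ∑ k ∈ Finset.range N, zetaTerm k s =
      (s - 1) * ∑ k ∈ Finset.range N, ((k + 1 : ℕ) : ℂ) ^ (-s) + ((N + 1 : ℕ) : ℂ) ^ (1 - s) - 1 := by
  induction N with
  | zero => simp
  | succ N ih => rw [Finset.sum_range_succ, Finset.sum_range_succ, ih, zetaTerm]; push_cast; ring_nf

lemma summable_nat_succ_rpow {p : ℝ} (hp : p < -1) :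
    Summable fun k : ℕ => ((k + 1 : ℕ) : ℝ) ^ p :=
  (summable_nat_add_iff 1).mpr (Real.summable_nat_rpow.mpr hp)

lemma summable_zetaTerm {s : ℂ} (hs : 0 < s.re) : Summable fun k => zetaTerm k s :=
  Summable.of_norm_bounded ((summable_nat_succ_rpow (by linarith : -s.re - 1 < -1)).mul_left _)
    fun k => norm_zetaTerm_le k hs.le

lemma tsum_zetaTerm_of_one_lt {s : ℂ} (hs : 1 < s.re) :
    ∑' k, zetaTerm k s = (s - 1) * riemannZeta s - 1 := by
  have h1 := (summable_zetaTerm (by linarith : 0 < s.re)).hasSum.tendsto_sum_nat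
  have h2 : Tendsto (fun N => ∑ k ∈ Finset.range N, ((k + 1 : ℕ) : ℂ) ^ (-s)) atTop
      (𝓝 (riemannZeta s)) := by
    have hsum : Summable fun k : ℕ => ((k + 1 : ℕ) : ℂ) ^ (-s) := by
      refine Summable.of_norm_bounded (summable_nat_succ_rpow (by linarith : -s.re < -1))
        fun k => ?_
      rw [norm_natCast_cpow_of_pos (Nat.succ_pos k), neg_re]
    have := hsum.hasSum.tendsto_sum_nat
    convert this using 2
    rw [zeta_eq_tsum_one_div_nat_add_one_cpow hs]
    refine tsum_congr fun k => ?_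
    rw [cpow_neg, one_div]; push_cast; rfl
  have h3 : Tendsto (fun N : ℕ => ((N + 1 : ℕ) : ℂ) ^ (1 - s)) atTop (𝓝 0) := by
    rw [tendsto_zero_iff_norm_tendsto_zero]
    have : Tendsto (fun N : ℕ => ((N + 1 : ℕ) : ℝ) ^ (-(s.re - 1))) atTop (𝓝 0) :=
      (tendsto_rpow_neg_atTop (by linarith)).comp
        (tendsto_natCast_atTop_atTop.comp (tendsto_add_atTop_nat 1))
    refine this.congr fun N => ?_
    rw [norm_natCast_cpow_of_pos (Nat.succ_pos N), sub_re, one_re]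
    congr 1; ring
  refine tendsto_nhds_unique h1 ?_
  simp_rw [sum_range_zetaTerm]
  simpa using ((h2.const_mul (s - 1)).add h3).sub_const 1

lemma differentiable_zetaTerm (k : ℕ) : Differentiable ℂ (zetaTerm k) := by
  have h : ∀ n : ℕ, n ≠ 0 → ∀ f : ℂ → ℂ, Differentiable ℂ f →
      Differentiable ℂ fun s => (n : ℂ) ^ f s :=
    fun n hn f hf => hf.const_cpow (Or.inl (Nat.cast_ne_zero.mpr hn))
  exact (((differentiable_id.sub_const 1).mul (h _ k.succ_ne_zero _ differentiable_id.neg)).add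
    (h _ (k + 1).succ_ne_zero _ (differentiable_id.const_sub 1))).sub
    (h _ k.succ_ne_zero _ (differentiable_id.const_sub 1))

lemma differentiableOn_tsum_zetaTerm :
    DifferentiableOn ℂ (fun s => ∑' k, zetaTerm k s) {s | 0 < s.re} := by
  intro s₀ hs₀
  simp only [mem_ofPred_eq] at hs₀
  -- The half-plane keeps the exponent below `-1` and the ball bounds `‖s - 1‖ * ‖s‖`, so one
  -- summable majorant serves a whole neighbourhood of `s₀`.
  set U : Set ℂ := {s | s₀.re / 2 < s.re} ∩ Metric.ball 0 (‖s₀‖ + 1) with hU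
  have hUo : IsOpen U := (isOpen_lt continuous_const continuous_re).inter Metric.isOpen_ball
  have hmem : s₀ ∈ U := ⟨by simp only [mem_ofPred_eq]; linarith, by simp⟩
  have hd : DifferentiableOn ℂ (fun s => ∑' k, zetaTerm k s) U := by
    refine differentiableOn_tsum_of_summable_norm
      (u := fun k => (‖s₀‖ + 2) * (‖s₀‖ + 1) * ((k + 1 : ℕ) : ℝ) ^ (-(s₀.re / 2) - 1))
      ((summable_nat_succ_rpow (by linarith)).mul_left _)
      (fun k => (differentiable_zetaTerm k).differentiableOn) hUo fun k s hs => ?_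
    obtain ⟨h1, h2⟩ := hs
    simp only [mem_ofPred_eq, mem_ball_zero_iff] at h1 h2
    refine (norm_zetaTerm_le k (by linarith)).trans ?_
    gcongr
    · calc ‖s - 1‖ ≤ ‖s‖ + ‖(1 : ℂ)‖ := norm_sub_le _ _
        _ ≤ ‖s₀‖ + 2 := by rw [norm_one]; linarith
    · exact_mod_cast Nat.succ_pos k
  exact (hd.differentiableAt (hUo.mem_nhds hmem)).differentiableWithinAt

/-- Analytic continuation: both sides, with `(s - 1) ζ(s)` read as the entire `riemannZeta₁`, are
analytic on `Re s > 0` and agree on `Re s > 1`. -/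
lemma tsum_zetaTerm {s : ℂ} (hs : 0 < s.re) (hs1 : s ≠ 1) :
    ∑' k, zetaTerm k s = (s - 1) * riemannZeta s - 1 := by
  have hopen : IsOpen {s : ℂ | 0 < s.re} := isOpen_lt continuous_const continuous_re
  have hEq : EqOn (fun s => ∑' k, zetaTerm k s) (fun s => riemannZeta₁ s - 1)
      {s : ℂ | 0 < s.re} := by
    refine AnalyticOnNhd.eqOn_of_preconnected_of_eventuallyEq (z₀ := 2)
      (differentiableOn_tsum_zetaTerm.analyticOnNhd hopen)
      ((by fun_prop : Differentiable ℂ fun s => riemannZeta₁ s - 1).differentiableOn.analyticOnNhd hopen)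
      (convex_halfSpace_re_gt 0).isPreconnected (by simp) ?_
    filter_upwards [(isOpen_lt continuous_const continuous_re).mem_nhds
      (by simp : (2 : ℂ) ∈ {s : ℂ | 1 < s.re})] with s hs
    rw [tsum_zetaTerm_of_one_lt hs]
    have : s ≠ 1 := by rintro rfl; simp at hs
    rw [riemannZeta_eq_inv_sub_mul this, mul_inv_cancel_left₀ (sub_ne_zero.mpr this)]
  rw [show ∑' k, zetaTerm k s = riemannZeta₁ s - 1 from hEq hs,
    riemannZeta_eq_inv_sub_mul hs1, mul_inv_cancel_left₀ (sub_ne_zero.mpr hs1)]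

/-- Truncation of the zeta function, with the pole term. -/
lemma exists_norm_zeta_sub_sum_le : ∃ C, 0 ≤ C ∧ ∀ s : ℂ, 1 / 4 ≤ s.re → s ≠ 1 → ∀ X : ℝ, 1 ≤ X →
    ‖riemannZeta s - ∑ k ∈ Finset.Icc 1 ⌊X⌋₊, (k : ℂ) ^ (-s) - (X : ℂ) ^ (1 - s) / (s - 1)‖ ≤
      C * (1 + ‖s‖) * X ^ (-(1 / 8) : ℝ) := by
  -- For `Re s ≥ 1/4` the tail terms decay with exponent `-5/4 = -1/8 - 9/8`: the first part gives
  -- the saving in `X`, the second keeps the series convergent.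
  set D : ℝ := ∑' k : ℕ, ((k + 1 : ℕ) : ℝ) ^ (-(9 / 8) : ℝ) with hD
  have hD0 : 0 ≤ D := tsum_nonneg fun k => by positivity
  refine ⟨D + 1, by positivity, fun s hs hs1 X hX => ?_⟩
  have hs1' : s - 1 ≠ 0 := sub_ne_zero.mpr hs1
  set N := ⌊X⌋₊ with hN
  have hNX : X < N + 1 := Nat.lt_floor_add_one X
  have hNX' : (N : ℝ) ≤ X := Nat.floor_le (by linarith)
  have hX0 : 0 < X := by linarith
  have hsum := (summable_zetaTerm (by linarith : 0 < s.re))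
  have hsplit := hsum.sum_add_tsum_nat_add N
  rw [tsum_zetaTerm (by linarith) hs1, sum_range_zetaTerm] at hsplit
  have hIcc : ∑ k ∈ Finset.Icc 1 N, (k : ℂ) ^ (-s) =
      ∑ k ∈ Finset.range N, ((k + 1 : ℕ) : ℂ) ^ (-s) := by
    rw [Finset.range_eq_Ico, Finset.sum_Ico_add' (fun k : ℕ => (k : ℂ) ^ (-s)) 0 N 1]
    rfl
  have hid : riemannZeta s - ∑ k ∈ Finset.Icc 1 N, (k : ℂ) ^ (-s) - (X : ℂ) ^ (1 - s) / (s - 1) =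
      (∑' k, zetaTerm (k + N) s +
        (((N + 1 : ℝ) : ℂ) ^ (1 - s) - (X : ℂ) ^ (1 - s))) / (s - 1) := by
    rw [hIcc]
    field_simp
    push_cast at hsplit ⊢
    linear_combination -hsplit
  have htail : ‖∑' k, zetaTerm (k + N) s‖ ≤ ‖s - 1‖ * ‖s‖ * X ^ (-(1 / 8) : ℝ) * D := by
    refine tsum_of_norm_bounded ((summable_nat_succ_rpow (by norm_num)).hasSum.mul_left
      (‖s - 1‖ * ‖s‖ * X ^ (-(1 / 8) : ℝ))) fun k => ?_
    refine (norm_zetaTerm_le (k + N) (by linarith)).trans ?_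
    rw [mul_assoc _ (X ^ _)]
    gcongr ?_ * ?_
    have h1 : (1 : ℝ) ≤ ((k + N + 1 : ℕ) : ℝ) := by exact_mod_cast Nat.succ_le_succ (Nat.zero_le _)
    calc ((k + N + 1 : ℕ) : ℝ) ^ (-s.re - 1) ≤ ((k + N + 1 : ℕ) : ℝ) ^ (-(1 / 8) + -(9 / 8) : ℝ) :=
          Real.rpow_le_rpow_of_exponent_le h1 (by linarith)
      _ = ((k + N + 1 : ℕ) : ℝ) ^ (-(1 / 8) : ℝ) * ((k + N + 1 : ℕ) : ℝ) ^ (-(9 / 8) : ℝ) :=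
          Real.rpow_add (by linarith) _ _
      _ ≤ X ^ (-(1 / 8) : ℝ) * ((k + 1 : ℕ) : ℝ) ^ (-(9 / 8) : ℝ) := by
          gcongr ?_ * ?_
          · refine Real.rpow_le_rpow_of_nonpos hX0 ?_ (by norm_num)
            push_cast
            linarith [(Nat.cast_nonneg k : (0 : ℝ) ≤ k)]
          · refine Real.rpow_le_rpow_of_nonpos (by positivity) ?_ (by norm_num)
            push_cast
            linarith [(Nat.cast_nonneg N : (0 : ℝ) ≤ N)]
  -- Telescoping ends at `N + 1` rather than at the real number `X`; the two are at most one apart.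
  have hedge : ‖((N + 1 : ℝ) : ℂ) ^ (1 - s) - (X : ℂ) ^ (1 - s)‖ ≤
      ‖s - 1‖ * X ^ (-(1 / 8) : ℝ) := by
    refine (norm_cpow_sub_cpow_le (1 - s) hX0 hNX.le (by simp; linarith)).trans ?_
    rw [norm_sub_rev, sub_re, one_re, mul_assoc]
    gcongr ?_ * ?_
    calc X ^ (1 - s.re - 1) * (↑N + 1 - X) ≤ X ^ (1 - s.re - 1) * 1 := by
          gcongr; linarith
      _ ≤ X ^ (-(1 / 8) : ℝ) := by
          rw [mul_one]; exact Real.rpow_le_rpow_of_exponent_le hX (by linarith)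
  rw [hid, norm_div, div_le_iff₀ (norm_pos_iff.mpr hs1')]
  refine (norm_add_le _ _).trans ((add_le_add htail hedge).trans ?_)
  have hp : 0 ≤ ‖s - 1‖ * X ^ (-(1 / 8) : ℝ) := by positivity
  nlinarith [mul_nonneg hp (norm_nonneg s), mul_nonneg hp hD0]

/-! ### Smooth truncation of zeta with no pole term. -/

lemma ofReal_rexp_cpow (v : ℝ) (c : ℂ) : ((Real.exp v : ℝ) : ℂ) ^ c = cexp (c * v) := by
  rw [cpow_def_of_ne_zero (by exact_mod_cast (Real.exp_pos v).ne'),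
    ← ofReal_log (Real.exp_pos v).le, Real.log_exp, mul_comm]

lemma integral_Ioi_zero_eq_integral_rexp (g : ℝ → ℂ) :
    ∫ x in Ioi (0 : ℝ), g x = ∫ v : ℝ, (Real.exp v : ℂ) * g (Real.exp v) := by
  rw [← Real.range_exp, ← image_univ,
    integral_image_eq_integral_abs_deriv_smul MeasurableSet.univ
      (fun x _ => (Real.hasDerivAt_exp x).hasDerivWithinAt) (Real.exp_injective.injOn)]
  simp [abs_of_pos (Real.exp_pos _), Complex.real_smul]

/-- Sharp truncations of length `X e^v` are averaged against this probability density. Its support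
in `[0, 1]` keeps the lengths between `X` and `eX ≤ 3X`. -/
lemma exists_averaging_weight : ∃ w : ℝ → ℝ, ContDiff ℝ ∞ w ∧ HasCompactSupport w ∧
    (∀ v, 0 ≤ w v) ∧ ∫ v, w v = 1 ∧ ∀ v, v ∉ Icc (0 : ℝ) 1 → w v = 0 := by
  let f : ContDiffBump (1 / 2 : ℝ) := ⟨1 / 4, 1 / 2, by norm_num, by norm_num⟩
  refine ⟨f.normed volume, f.contDiff_normed, f.hasCompactSupport_normed, f.nonneg_normed,
    f.integral_normed, fun v hv => ?_⟩
  rw [← Function.notMem_support, f.support_normed_eq]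
  contrapose! hv
  have hv : |v - 1 / 2| < 1 / 2 := by simpa [Real.dist_eq, f] using hv
  rw [abs_lt] at hv
  exact ⟨by linarith [hv.1], by linarith [hv.2]⟩

/-- A smoothed approximation of `ζ` by Dirichlet polynomials, away from the pole. -/
theorem exists_smooth_zeta_approx : ∃ W : ℝ → ℝ, (∀ y, 0 ≤ W y ∧ W y ≤ 1) ∧ (∀ y ≤ 1, W y = 1) ∧
    ∀ K : ℕ, ∃ C, 0 ≤ C ∧ ∀ s : ℂ, 1 / 4 ≤ s.re → s.re ≤ 3 / 4 →
      ∀ X : ℝ, 1 ≤ X →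
      ‖riemannZeta s - ∑ k ∈ Finset.Icc 1 ⌊3 * X⌋₊, (W (k / X) : ℂ) * (k : ℂ) ^ (-s)‖ ≤
        C * ((1 + ‖s‖) * X ^ (-(1 / 8) : ℝ) + X / ‖s - 1‖ ^ K) := by
  obtain ⟨w, hw, hwc, hw0, hw1, hws⟩ := exists_averaging_weight
  have hwi : Integrable w := hw.continuous.integrable_of_hasCompactSupport hwc
  have hmeas : ∀ y : ℝ, MeasurableSet {v : ℝ | y ≤ Real.exp v} := fun y =>
    measurableSet_le measurable_const Real.measurable_exp
  -- `W (k / X)` is the proportion of the truncations `X e^v` that contain `k`.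
  refine ⟨fun y => ∫ v in {v : ℝ | y ≤ Real.exp v}, w v, fun y => ⟨?_, ?_⟩, fun y hy => ?_,
    fun K => ?_⟩
  · exact setIntegral_nonneg (hmeas y) fun v _ => hw0 v
  · rw [← hw1]
    exact setIntegral_le_integral hwi (Eventually.of_forall hw0)
  · rw [← hw1]
    refine setIntegral_eq_integral_of_forall_compl_eq_zero fun v hv => hws v fun hv' => hv ?_
    exact hy.trans (Real.one_le_exp hv'.1)
  obtain ⟨C₁, hC₁, hsharp⟩ := exists_norm_zeta_sub_sum_le
  have hwC : ContDiff ℝ ∞ fun v => (w v : ℂ) := ofRealCLM.contDiff.comp hw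
  have hwCc : HasCompactSupport fun v => (w v : ℂ) := hwc.comp_left ofReal_zero
  -- The averaged pole term is `X^{1-s}/(s-1)` times the transform of `w` at `1 - s`; smoothness of
  -- `w` makes it smaller than any power of `‖s - 1‖`.
  obtain ⟨C₂, hC₂⟩ := exists_norm_oscIntegral_zero_mul_pow_le hwC hwCc 1 K
  have hwCi : Integrable fun v => (w v : ℂ) := hwi.ofReal
  refine ⟨C₁ + 4 * |C₂|, by positivity, fun s hs1 hs2 X hX => ?_⟩
  have hX0 : 0 < X := by linarith
  have hs : s ≠ 1 := by rintro rfl; norm_num at hs2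
  have hnorm : 1 / 4 ≤ ‖s - 1‖ := by
    have := abs_re_le_norm (s - 1)
    rw [sub_re, one_re, abs_le] at this
    linarith [this.1]
  set J := Finset.Icc 1 ⌊3 * X⌋₊ with hJ
  set E : ℝ → ℂ := fun v => riemannZeta s -
    ∑ k ∈ Finset.Icc 1 ⌊X * Real.exp v⌋₊, (k : ℂ) ^ (-s) -
      ((X * Real.exp v : ℝ) : ℂ) ^ (1 - s) / (s - 1) with hE
  have hEdecomp : ∀ v, (w v : ℂ) * E v = (w v : ℂ) * riemannZeta s -
      ∑ k ∈ J, ({v : ℝ | (k : ℝ) / X ≤ Real.exp v}.indicator (fun v => (w v : ℂ)) v) *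
        (k : ℂ) ^ (-s) -
      (X : ℂ) ^ (1 - s) / (s - 1) * ((w v : ℂ) * cexp ((1 - s) * v)) := by
    intro v
    by_cases hv : v ∈ Icc (0 : ℝ) 1
    · have hexp : Real.exp v ≤ 3 := by
        have h1 : Real.exp v ≤ Real.exp 1 := Real.exp_le_exp.mpr hv.2
        linarith [Real.exp_one_lt_d9]
      have hcp : ((X * Real.exp v : ℝ) : ℂ) ^ (1 - s) = (X : ℂ) ^ (1 - s) * cexp ((1 - s) * v) := by
        rw [ofReal_mul, mul_cpow_ofReal_nonneg hX0.le (Real.exp_pos v).le, ofReal_rexp_cpow]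
      have hsum : ∑ k ∈ J, ({v : ℝ | (k : ℝ) / X ≤ Real.exp v}.indicator (fun v => (w v : ℂ)) v) *
          (k : ℂ) ^ (-s) = (w v : ℂ) * ∑ k ∈ Finset.Icc 1 ⌊X * Real.exp v⌋₊, (k : ℂ) ^ (-s) := by
        have hsub : Finset.Icc 1 ⌊X * Real.exp v⌋₊ ⊆ J := by
          apply Finset.Icc_subset_Icc_right
          apply Nat.floor_le_floor
          nlinarith
        rw [Finset.mul_sum, ← Finset.sum_subset hsub]
        · refine Finset.sum_congr rfl fun k hk => ?_
          rw [indicator_of_mem]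
          rw [mem_ofPred_eq, div_le_iff₀ hX0, mul_comm]
          exact (Nat.le_floor_iff (by positivity)).mp (Finset.mem_Icc.mp hk).2
        · intro k hk hk'
          rw [indicator_of_notMem, zero_mul]
          rw [mem_ofPred_eq, div_le_iff₀ hX0, mul_comm]
          intro h
          exact hk' (Finset.mem_Icc.mpr ⟨(Finset.mem_Icc.mp hk).1, Nat.le_floor h⟩)
      rw [hsum, hE]
      simp only
      rw [hcp]
      ring
    · simp [indicator_apply, hws v hv]
  have hint1 : Integrable fun v => (w v : ℂ) * riemannZeta s := hwCi.mul_const _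
  have hint2 : Integrable fun v => ∑ k ∈ J,
      ({v : ℝ | (k : ℝ) / X ≤ Real.exp v}.indicator (fun v => (w v : ℂ)) v) * (k : ℂ) ^ (-s) :=
    integrable_finsetSum _ fun k _ => (hwCi.indicator (hmeas _)).mul_const _
  have hint3 : Integrable fun v : ℝ => (X : ℂ) ^ (1 - s) / (s - 1) *
      ((w v : ℂ) * cexp ((1 - s) * v)) := by
    refine Integrable.const_mul ?_ _
    exact Continuous.integrable_of_hasCompactSupport
      (hwC.continuous.mul (by fun_prop)) hwCc.mul_right
  have hint12 : Integrable fun v => (w v : ℂ) * riemannZeta s - ∑ k ∈ J,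
      ({v : ℝ | (k : ℝ) / X ≤ Real.exp v}.indicator (fun v => (w v : ℂ)) v) * (k : ℂ) ^ (-s) :=
    hint1.sub hint2
  have hEint : ∫ v, (w v : ℂ) * E v = riemannZeta s -
      ∑ k ∈ J, ((∫ v in {v : ℝ | (k : ℝ) / X ≤ Real.exp v}, w v : ℝ) : ℂ) * (k : ℂ) ^ (-s) -
      (X : ℂ) ^ (1 - s) / (s - 1) * oscIntegral (fun v => (w v : ℂ)) (1 - s) 0 := by
    simp_rw [hEdecomp]
    rw [integral_sub hint12 hint3, integral_sub hint1 hint2, integral_mul_const,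
      integral_complex_ofReal, hw1, ofReal_one, one_mul, integral_finsetSum _
        fun k _ => (hwCi.indicator (hmeas _)).mul_const _, integral_const_mul]
    congr 2
    · refine Finset.sum_congr rfl fun k _ => ?_
      rw [integral_mul_const, integral_indicator (hmeas _), integral_complex_ofReal]
    · simp [oscIntegral]
  have hEbound : ‖∫ v, (w v : ℂ) * E v‖ ≤ C₁ * (1 + ‖s‖) * X ^ (-(1 / 8) : ℝ) := by
    have : ∫ v, w v * (C₁ * (1 + ‖s‖) * X ^ (-(1 / 8) : ℝ)) =
        C₁ * (1 + ‖s‖) * X ^ (-(1 / 8) : ℝ) := by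
      rw [integral_mul_const, hw1, one_mul]
    rw [← this]
    refine norm_integral_le_of_norm_le (hwi.mul_const _) (Eventually.of_forall fun v => ?_)
    rw [norm_mul, norm_real, Real.norm_of_nonneg (hw0 v)]
    by_cases hv : v ∈ Icc (0 : ℝ) 1
    · have he := Real.one_le_exp hv.1
      have hXX : X ≤ X * Real.exp v := le_mul_of_one_le_right hX0.le he
      refine mul_le_mul_of_nonneg_left ((hsharp s hs1 hs _ (hX.trans hXX)).trans ?_) (hw0 v)
      refine mul_le_mul_of_nonneg_left ?_ (by positivity)
      exact Real.rpow_le_rpow_of_nonpos hX0 hXX (by norm_num)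
    · simp [hws v hv]
  have hosc : ‖(X : ℂ) ^ (1 - s) / (s - 1) * oscIntegral (fun v => (w v : ℂ)) (1 - s) 0‖ ≤
      4 * |C₂| * (X / ‖s - 1‖ ^ K) := by
    have h1 := hC₂ (1 - s) (by rw [sub_re, one_re, abs_le]; constructor <;> linarith)
    rw [norm_sub_rev 1 s, ← le_div_iff₀ (by positivity)] at h1
    have h2 : ‖(X : ℂ) ^ (1 - s)‖ ≤ X := by
      rw [norm_cpow_eq_rpow_re_of_pos hX0, sub_re, one_re]
      calc X ^ (1 - s.re) ≤ X ^ (1 : ℝ) := Real.rpow_le_rpow_of_exponent_le hX (by linarith)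
        _ = X := Real.rpow_one X
    rw [norm_mul, norm_div]
    calc ‖(X : ℂ) ^ (1 - s)‖ / ‖s - 1‖ * ‖oscIntegral (fun v => (w v : ℂ)) (1 - s) 0‖
        ≤ X / (1 / 4) * (|C₂| / ‖s - 1‖ ^ K) := by
          gcongr
          exact h1.trans (by gcongr; exact le_abs_self _)
      _ = 4 * |C₂| * (X / ‖s - 1‖ ^ K) := by ring
  have hfin : riemannZeta s -
      ∑ k ∈ J, ((∫ v in {v : ℝ | (k : ℝ) / X ≤ Real.exp v}, w v : ℝ) : ℂ) * (k : ℂ) ^ (-s) =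
      (∫ v, (w v : ℂ) * E v) +
        (X : ℂ) ^ (1 - s) / (s - 1) * oscIntegral (fun v => (w v : ℂ)) (1 - s) 0 := by
    rw [hEint]; ring
  rw [hfin]
  refine (norm_add_le _ _).trans ((add_le_add hEbound hosc).trans ?_)
  have p1 : 0 ≤ (1 + ‖s‖) * X ^ (-(1 / 8) : ℝ) := by positivity
  have p2 : 0 ≤ X / ‖s - 1‖ ^ K := by positivity
  nlinarith [mul_nonneg hC₁ p2, mul_nonneg (abs_nonneg C₂) p1]

/-! ### Mellin inversion and the kernel as a double series. -/

lemma hasCompactSupport_comp_rexp {φ : ℝ → ℝ} (hc : HasCompactSupport φ)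
    (hp : tsupport φ ⊆ Ioi 0) : HasCompactSupport fun v => φ (Real.exp v) := by
  refine HasCompactSupport.intro (K := Real.log '' tsupport φ)
    (IsCompact.image_of_continuousOn hc (Real.continuousOn_log.mono fun x hx => ?_)) fun v hv => ?_
  · exact (hp hx : 0 < x).ne'
  · by_contra h
    exact hv ⟨Real.exp v, subset_tsupport φ h, Real.log_exp v⟩

lemma contDiff_ofReal_comp_rexp {φ : ℝ → ℝ} (hφ : ContDiff ℝ ∞ φ) :
    ContDiff ℝ ∞ fun v => (φ (Real.exp v) : ℂ) :=
  ofRealCLM.contDiff.comp (hφ.comp Real.contDiff_exp)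

lemma mellinConvergent_of_test {φ : ℝ → ℝ} (hφ : Continuous φ) (hc : HasCompactSupport φ)
    (hp : tsupport φ ⊆ Ioi 0) (s : ℂ) : MellinConvergent (fun x => (φ x : ℂ)) s := by
  have hcont : Continuous fun t : ℝ => (t : ℂ) ^ (s - 1) • (φ t : ℂ) := by
    rw [continuous_iff_continuousAt]
    intro t
    by_cases ht : t ∈ tsupport φ
    · have h0 : 0 < t := hp ht
      exact (hasDerivAt_ofReal_cpow_pos (s - 1) h0).continuousAt.smul
        (continuous_ofReal.comp hφ).continuousAt
    · have h0 : ∀ᶠ x in 𝓝 t, φ x = 0 := by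
        rw [notMem_tsupport_iff_eventuallyEq] at ht
        exact ht
      have h1 : (fun t : ℝ => (t : ℂ) ^ (s - 1) • (φ t : ℂ)) =ᶠ[𝓝 t] fun _ => 0 := by
        filter_upwards [h0] with x hx
        simp [hx]
      exact (continuousAt_const (y := (0 : ℂ))).congr (EventuallyEq.symm h1)
  have hcs : HasCompactSupport fun t : ℝ => (φ t : ℂ) := hc.comp_left (g := ofReal) ofReal_zero
  have hcs' : HasCompactSupport fun t : ℝ => (t : ℂ) ^ (s - 1) * (φ t : ℂ) := hcs.mul_left
  exact (hcont.integrable_of_hasCompactSupport hcs').integrableOn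

/-- On a vertical line the Mellin transform is, after rescaling, the Fourier transform of `e^{-σu}
φ(e^{-u})`. This is a test function because `φ` is supported away from `0`, so its transform is
Schwartz. -/
lemma verticalIntegrable_mellin {φ : ℝ → ℝ} (hφ : ContDiff ℝ ∞ φ) (hc : HasCompactSupport φ)
    (hp : tsupport φ ⊆ Ioi 0) (σ : ℝ) :
    VerticalIntegrable (mellin fun x => (φ x : ℂ)) σ := by
  set g : ℝ → ℂ := fun u => (Real.exp (-σ * u) : ℂ) * (φ (Real.exp (-u)) : ℂ) with hg
  have hgs : ContDiff ℝ ∞ g := by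
    have h1 : ContDiff ℝ ∞ fun u : ℝ => (Real.exp (-σ * u) : ℂ) :=
      ofRealCLM.contDiff.comp (by fun_prop : ContDiff ℝ ∞ fun u : ℝ => Real.exp (-σ * u))
    have h2 : ContDiff ℝ ∞ fun u : ℝ => (φ (Real.exp (-u)) : ℂ) :=
      (contDiff_ofReal_comp_rexp hφ).comp contDiff_neg
    exact h1.mul h2
  have hgc : HasCompactSupport g := by
    have h1 : HasCompactSupport fun u : ℝ => φ (Real.exp (-u)) :=
      (hasCompactSupport_comp_rexp hc hp).comp_homeomorph (Homeomorph.neg ℝ)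
    have h2 : HasCompactSupport fun u : ℝ => (φ (Real.exp (-u)) : ℂ) :=
      h1.comp_left (g := ofReal) ofReal_zero
    exact h2.mul_left
  have hF : Integrable (𝓕 g) := by
    have := (𝓕 (hgc.toSchwartzMap hgs)).integrable (μ := volume)
    rwa [SchwartzMap.fourier_coe] at this
  have h2π : (2 * Real.pi)⁻¹ ≠ 0 := by positivity
  refine (hF.comp_mul_right' h2π).congr (Eventually.of_forall fun y => ?_)
  simp [mellin_eq_fourier, hg, div_eq_mul_inv]

lemma summable_natPair {p q : ℝ} (hp : 1 < p) (hq : 1 < q) :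
    Summable fun n : ℕ × ℕ => ((n.1 + 1 : ℕ) : ℝ) ^ (-p) * ((n.2 + 1 : ℕ) : ℝ) ^ (-q) :=
  (summable_nat_succ_rpow (neg_lt_neg hp)).mul_of_nonneg (summable_nat_succ_rpow (neg_lt_neg hq))
    (fun _ => by positivity) (fun _ => by positivity)

lemma riemannZeta_mul_riemannZeta {s w : ℂ} (hs : 1 < s.re) (hw : 1 < w.re) :
    riemannZeta s * riemannZeta w =
      ∑' n : ℕ × ℕ, ((n.1 + 1 : ℕ) : ℂ) ^ (-s) * ((n.2 + 1 : ℕ) : ℂ) ^ (-w) := by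
  have hz : ∀ {s : ℂ}, 1 < s.re → (Summable fun k : ℕ => ‖((k + 1 : ℕ) : ℂ) ^ (-s)‖) ∧
      riemannZeta s = ∑' k : ℕ, ((k + 1 : ℕ) : ℂ) ^ (-s) := by
    intro s hs
    constructor
    · refine (summable_nat_succ_rpow (by linarith : -s.re < -1)).congr fun k => ?_
      rw [norm_natCast_cpow_of_pos (Nat.succ_pos k), neg_re]
    · rw [zeta_eq_tsum_one_div_nat_add_one_cpow hs]
      refine tsum_congr fun k => ?_
      rw [cpow_neg, one_div]; push_cast; rfl
  rw [(hz hs).2, (hz hw).2]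
  exact tsum_mul_tsum_of_summable_norm (hz hs).1 (hz hw).1

/-- The kernel `F_γ` as a double Dirichlet series. -/
theorem kernelF_eq_tsum {φ : ℝ → ℝ} (hφ : ContDiff ℝ ∞ φ) (hc : HasCompactSupport φ)
    (hp : tsupport φ ⊆ Ioi 0) {γ : ℂ} (hγ : |γ.re| < 1) {x : ℝ} (hx : 0 < x) :
    kernelF φ γ x = (x : ℂ)⁻¹ * ∑' n : ℕ × ℕ, ((n.1 + 1 : ℕ) : ℂ) ^ (-(2 * γ)) *
      (φ (((n.1 + 1 : ℕ) : ℝ) * ((n.2 + 1 : ℕ) : ℝ) / x) : ℂ) := by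
  rw [abs_lt] at hγ
  -- In the variable `s - γ` the line of integration becomes `Re = σ`. As `|Re γ| < 1`, both `s + γ`
  -- and `s - γ` lie in the half-plane of absolute convergence.
  set σ : ℝ := 2 - γ.re with hσ
  set f : ℝ → ℂ := fun x => (φ x : ℂ) with hf
  set F : ℕ × ℕ → ℝ → ℂ := fun n y => mellin f (σ + y * I) * (x : ℂ) ^ (σ + y * I - 1) *
    (((n.1 + 1 : ℕ) : ℂ) ^ (-(σ + y * I + 2 * γ)) * ((n.2 + 1 : ℕ) : ℂ) ^ (-(σ + y * I))) with hF
  have hxC : (x : ℂ) ≠ 0 := by exact_mod_cast hx.ne'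
  have hnorm : ∀ n y, ‖F n y‖ = ‖mellin f (σ + y * I)‖ * x ^ (σ - 1) *
      (((n.1 + 1 : ℕ) : ℝ) ^ (-(2 + γ.re)) * ((n.2 + 1 : ℕ) : ℝ) ^ (-σ)) := by
    intro n y
    simp only [hF]
    rw [norm_mul, norm_mul, norm_mul, norm_cpow_eq_rpow_re_of_pos hx,
      norm_natCast_cpow_of_pos (Nat.succ_pos _), norm_natCast_cpow_of_pos (Nat.succ_pos _)]
    congr 2
    · simp
    · congr 1
      simp [hσ]; ring
    · simp
  have hterm : ∀ n y, F n y = (x : ℂ)⁻¹ * ((n.1 + 1 : ℕ) : ℂ) ^ (-(2 * γ)) *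
      (((((n.1 + 1 : ℕ) : ℝ) * ((n.2 + 1 : ℕ) : ℝ) / x : ℝ) : ℂ) ^ (-(σ + y * I)) *
        mellin f (σ + y * I)) := by
    intro n y
    simp only [hF]
    have h1 : ((n.1 + 1 : ℕ) : ℂ) ≠ 0 := Nat.cast_ne_zero.mpr n.1.succ_ne_zero
    have hdiv : ((((n.1 + 1 : ℕ) : ℝ) * ((n.2 + 1 : ℕ) : ℝ) / x : ℝ) : ℂ) ^ (-((σ : ℂ) + y * I)) =
        ((n.1 + 1 : ℕ) : ℂ) ^ (-((σ : ℂ) + y * I)) * ((n.2 + 1 : ℕ) : ℂ) ^ (-((σ : ℂ) + y * I)) *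
          (x : ℂ) ^ ((σ : ℂ) + y * I) := by
      rw [div_eq_mul_inv, ofReal_mul, mul_cpow_ofReal_nonneg (by positivity) (by positivity),
        ofReal_mul, mul_cpow_ofReal_nonneg (by positivity) (by positivity), ofReal_inv,
        inv_cpow _ _ (by rw [arg_ofReal_of_nonneg hx.le]; exact Real.pi_pos.ne), cpow_neg (x : ℂ),
        inv_inv]
      simp
    rw [hdiv, cpow_sub _ _ hxC, cpow_one, neg_add, cpow_add _ _ h1]
    field_simp
  have hmel : Integrable fun y : ℝ => mellin f (σ + y * I) := verticalIntegrable_mellin hφ hc hp σ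
  have hFcont : ∀ n, Integrable (F n) := by
    intro n
    have h0 : Continuous fun y : ℝ => (x : ℂ) ^ ((σ : ℂ) + y * I - 1) *
        (((n.1 + 1 : ℕ) : ℂ) ^ (-((σ : ℂ) + y * I + 2 * γ)) *
          ((n.2 + 1 : ℕ) : ℂ) ^ (-((σ : ℂ) + y * I))) := by
      have hh : ∀ (z : ℂ) (g : ℝ → ℂ), z ≠ 0 → Continuous g → Continuous fun y => z ^ g y :=
        fun z g hz hg => hg.const_cpow (Or.inl hz)
      exact (hh _ _ hxC (by fun_prop)).mul ((hh _ _ (Nat.cast_ne_zero.mpr n.1.succ_ne_zero)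
        (by fun_prop)).mul (hh _ _ (Nat.cast_ne_zero.mpr n.2.succ_ne_zero) (by fun_prop)))
    refine ((hmel.norm.mul_const (x ^ (σ - 1))).mul_const
      (((n.1 + 1 : ℕ) : ℝ) ^ (-(2 + γ.re)) * ((n.2 + 1 : ℕ) : ℝ) ^ (-σ))).mono' ?_
      (Eventually.of_forall fun y => (hnorm n y).le)
    have := hmel.aestronglyMeasurable.mul h0.aestronglyMeasurable
    refine this.congr (Eventually.of_forall fun y => ?_)
    simp only [hF, Pi.mul_apply, mul_assoc]
  have hsum : Summable fun n => ∫ y, ‖F n y‖ := by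
    have : (fun n => ∫ y, ‖F n y‖) = fun n : ℕ × ℕ =>
        ((∫ y : ℝ, ‖mellin f (σ + y * I)‖) * x ^ (σ - 1)) *
          (((n.1 + 1 : ℕ) : ℝ) ^ (-(2 + γ.re)) * ((n.2 + 1 : ℕ) : ℝ) ^ (-σ)) := by
      ext n
      simp_rw [hnorm]
      rw [integral_mul_const, integral_mul_const]
    rw [this]
    exact (summable_natPair (by linarith) (by linarith)).mul_left _
  have hint : ∫ y : ℝ, mellinTransform φ (((2 : ℝ) : ℂ) + y * I - γ) *
        (x : ℂ) ^ (((2 : ℝ) : ℂ) + y * I - γ - 1) * riemannZeta (((2 : ℝ) : ℂ) + y * I + γ) *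
        riemannZeta (((2 : ℝ) : ℂ) + y * I - γ) = ∑' n, ∫ y, F n y := by
    rw [integral_tsum_of_summable_integral_norm hFcont hsum,
      -- Translating `y` by `Im γ` absorbs the imaginary part of the shift.
      ← integral_sub_right_eq_self (fun y => ∑' n, F n y) γ.im]
    congr 1; ext y
    have e1 : ((2 : ℝ) : ℂ) + y * I - γ = σ + ((y - γ.im : ℝ) : ℂ) * I := by
      apply Complex.ext <;> simp [hσ]
    have e2 : ((2 : ℝ) : ℂ) + y * I + γ = σ + ((y - γ.im : ℝ) : ℂ) * I + 2 * γ := by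
      rw [← e1]; ring
    rw [e1, e2, mul_assoc, riemannZeta_mul_riemannZeta
      (by simp [hσ]; linarith) (by simp [hσ]; linarith), ← tsum_mul_left]
    rfl
  have hinv : ∀ n : ℕ × ℕ, ∫ y, F n y = (x : ℂ)⁻¹ * ((n.1 + 1 : ℕ) : ℂ) ^ (-(2 * γ)) *
      (2 * Real.pi * (φ (((n.1 + 1 : ℕ) : ℝ) * ((n.2 + 1 : ℕ) : ℝ) / x) : ℂ)) := by
    intro n
    simp_rw [hterm]
    rw [integral_const_mul]
    congr 1
    have := mellinInv_mellin_eq σ f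
      (x := ((n.1 + 1 : ℕ) : ℝ) * ((n.2 + 1 : ℕ) : ℝ) / x) (by positivity)
      (mellinConvergent_of_test hφ.continuous hc hp σ) hmel
      (continuous_ofReal.comp hφ.continuous).continuousAt
    rw [mellinInv] at this
    simp only [smul_eq_mul] at this
    rw [show (φ (((n.1 + 1 : ℕ) : ℝ) * ((n.2 + 1 : ℕ) : ℝ) / x) : ℂ) =
      f (((n.1 + 1 : ℕ) : ℝ) * ((n.2 + 1 : ℕ) : ℝ) / x) from rfl, ← this, Complex.real_smul]
    have hpi : (Real.pi : ℂ) ≠ 0 := by exact_mod_cast Real.pi_ne_zero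
    have hZ : ∀ Z : ℂ, Z = 2 * Real.pi * (((1 / (2 * Real.pi) : ℝ) : ℂ) * Z) := by
      intro Z; push_cast; field_simp
    exact hZ _
  rw [kernelF, verticalIntegral, hint]
  simp_rw [hinv]
  rw [← tsum_mul_left, ← tsum_mul_left, ← tsum_mul_left]
  refine tsum_congr fun n => ?_
  have hpi : (Real.pi : ℂ) ≠ 0 := by exact_mod_cast Real.pi_ne_zero
  field_simp

/-! ### Evaluation of the dual terms at integer frequencies. -/

/-- A smooth cutoff equal to `1` on `[-1/2, 1/2]` and vanishing outside `(-1, 1)`. -/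
noncomputable def cutoffBump : ContDiffBump (0 : ℝ) := ⟨1 / 2, 1, by norm_num, by norm_num⟩

/-- The complex-valued version of `cutoffBump`. -/
noncomputable def cutoff (v : ℝ) : ℂ := (cutoffBump v : ℂ)

lemma contDiff_cutoff : ContDiff ℝ ∞ cutoff := ofRealCLM.contDiff.comp cutoffBump.contDiff

lemma hasCompactSupport_cutoff : HasCompactSupport cutoff :=
  cutoffBump.hasCompactSupport.comp_left (g := ofReal) ofReal_zero

lemma cutoff_eq_one {v : ℝ} (hv : |v| ≤ 1 / 2) : cutoff v = 1 := by
  rw [cutoff, cutoffBump.one_of_mem_closedBall (by simpa [cutoffBump] using hv), ofReal_one]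

lemma cutoff_eq_zero {v : ℝ} (hv : 1 ≤ |v|) : cutoff v = 0 := by
  rw [cutoff, cutoffBump.zero_of_le_dist (by simpa [cutoffBump] using hv), ofReal_zero]

lemma norm_cutoff_sub_one_le (v : ℝ) : ‖cutoff v - 1‖ ≤ 1 := by
  rw [cutoff, ← ofReal_one, ← ofReal_sub, norm_real, Real.norm_eq_abs, abs_le]
  constructor <;> linarith [cutoffBump.nonneg (x := v), cutoffBump.le_one (x := v)]

lemma norm_cutoff_le (v : ℝ) : ‖cutoff v‖ ≤ 1 := by
  rw [cutoff, norm_real, Real.norm_of_nonneg cutoffBump.nonneg]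
  exact cutoffBump.le_one

/-- `∫ φ(t/T) (∫ ψ(v) e^{(1/2 - b + it)v} e(-m e^v) dv) dt` for the standard cutoff `ψ`. -/
noncomputable def dualTerm (φ : ℝ → ℝ) (b : ℂ) (T m : ℝ) : ℂ :=
  ∫ t : ℝ, (φ (t / T) : ℂ) * oscIntegral cutoff (1 / 2 - b + t * I) m

lemma hasCompactSupport_comp_div {φ : ℝ → ℝ} (hc : HasCompactSupport φ) {T : ℝ} (hT : 0 < T) :
    HasCompactSupport fun t => (φ (t / T) : ℂ) := by
  have h1 : HasCompactSupport fun t => φ (t / T) := by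
    have := hc.comp_homeomorph (Homeomorph.mulRight₀ T⁻¹ (inv_pos.mpr hT).ne')
    simp_rw [div_eq_mul_inv]
    exact this
  exact h1.comp_left (g := ofReal) ofReal_zero

lemma integrable_comp_div {φ : ℝ → ℝ} (hφ : Continuous φ) (hc : HasCompactSupport φ) {T : ℝ}
    (hT : 0 < T) : Integrable fun t => (φ (t / T) : ℂ) :=
  Continuous.integrable_of_hasCompactSupport (by fun_prop) (hasCompactSupport_comp_div hc hT)

/-- The inverse Fourier transform of a test function, as a Schwartz function. -/
noncomputable def invFourier (φ : ℝ → ℝ) (hφ : ContDiff ℝ ∞ φ) (hc : HasCompactSupport φ) :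
    𝓢(ℝ, ℂ) :=
  𝓕⁻ ((hc.comp_left (g := ofReal) ofReal_zero).toSchwartzMap
    (f := fun x => (φ x : ℂ)) (ofRealCLM.contDiff.comp hφ))

lemma invFourier_apply {φ : ℝ → ℝ} (hφ : ContDiff ℝ ∞ φ) (hc : HasCompactSupport φ) (w : ℝ) :
    invFourier φ hφ hc w = ∫ v : ℝ, (φ v : ℂ) * cexp (2 * Real.pi * w * v * I) := by
  rw [invFourier, SchwartzMap.fourierInv_coe, Real.fourierInv_eq']
  congr 1; ext v
  rw [smul_eq_mul, mul_comm]
  congr 2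
  simp
  ring

lemma integral_comp_div_mul_cexp {φ : ℝ → ℝ} (hφ : ContDiff ℝ ∞ φ) (hc : HasCompactSupport φ)
    {T : ℝ} (hT : 0 < T) (v : ℝ) :
    ∫ t : ℝ, (φ (t / T) : ℂ) * cexp (t * v * I) =
      T * invFourier φ hφ hc (T * v / (2 * Real.pi)) := by
  have h := Measure.integral_comp_div (fun u : ℝ => (φ u : ℂ) * cexp (((T * u : ℝ) : ℂ) * v * I)) T
  rw [abs_of_pos hT, Complex.real_smul] at h
  rw [invFourier_apply]
  have hpi : (Real.pi : ℂ) ≠ 0 := by exact_mod_cast Real.pi_ne_zero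
  convert h using 2
  · ext t
    rw [mul_div_cancel₀ _ hT.ne']
  · congr 1; ext u
    congr 2
    push_cast
    field_simp

/-- Fourier inversion for the model integral in which the phase `e^v` has been linearized to `v`. -/
lemma integral_invFourier_mul_cexp {φ : ℝ → ℝ} (hφ : ContDiff ℝ ∞ φ) (hc : HasCompactSupport φ)
    {T : ℝ} (hT : 0 < T) (m : ℝ) :
    ∫ v : ℝ, (T * invFourier φ hφ hc (T * v / (2 * Real.pi))) *
      cexp (-(2 * Real.pi * m * v : ℝ) * I) = 2 * Real.pi * φ (2 * Real.pi * m / T) := by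
  have hpi : (Real.pi : ℂ) ≠ 0 := by exact_mod_cast Real.pi_ne_zero
  have hTC : (T : ℂ) ≠ 0 := by exact_mod_cast hT.ne'
  have hinv : (φ (2 * Real.pi * m / T) : ℂ) =
      𝓕 (invFourier φ hφ hc) (2 * Real.pi * m / T) := by
    rw [invFourier, FourierTransform.fourier_fourierInv_eq]
    rfl
  rw [hinv, SchwartzMap.fourier_coe, Real.fourier_eq']
  have hpos : 0 < T / (2 * Real.pi) := by positivity
  have h := Measure.integral_comp_mul_left (fun w : ℝ =>
    cexp (((-2 * Real.pi * inner ℝ w (2 * Real.pi * m / T) : ℝ) : ℂ) * I) •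
      invFourier φ hφ hc w) (T / (2 * Real.pi))
  rw [abs_of_pos (inv_pos.mpr hpos), Complex.real_smul] at h
  have h2 : ∀ Z : ℂ, 2 * Real.pi * Z = T * ((((T / (2 * Real.pi))⁻¹ : ℝ) : ℂ) * Z) := by
    intro Z; push_cast; field_simp
  rw [h2, ← h, ← integral_const_mul]
  congr 1; ext v
  have e1 : T / (2 * Real.pi) * v = T * v / (2 * Real.pi) := by ring
  have e2 : -2 * Real.pi * inner ℝ (T * v / (2 * Real.pi)) (2 * Real.pi * m / T) =
      -(2 * Real.pi * m * v) := by
    simp only [RCLike.inner_apply, conj_trivial]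
    field_simp
  rw [e1, e2, smul_eq_mul]
  push_cast
  ring

/-- Integrating over `t` first produces a Schwartz weight that concentrates `v` at scale `1/T`. -/
lemma dualTerm_eq_integral {φ : ℝ → ℝ} (hφ : ContDiff ℝ ∞ φ) (hc : HasCompactSupport φ)
    {T : ℝ} (hT : 0 < T) (b : ℂ) (m : ℝ) :
    dualTerm φ b T m = ∫ v : ℝ, (T * invFourier φ hφ hc (T * v / (2 * Real.pi))) *
      (cutoff v * cexp ((1 / 2 - b) * v) * cexp (-(2 * Real.pi * m * Real.exp v : ℝ) * I)) := by
  have hφc := hφ.continuous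
  have hψc := contDiff_cutoff.continuous
  set f : ℝ → ℝ → ℂ := fun t v => (φ (t / T) : ℂ) * (cutoff v * cexp ((1 / 2 - b + t * I) * v) *
    cexp (-(2 * Real.pi * m * Real.exp v : ℝ) * I)) with hf
  have hcont : Continuous f.uncurry := by
    simp only [hf, Function.uncurry_def]
    fun_prop
  have hsupp : HasCompactSupport f.uncurry := by
    refine HasCompactSupport.intro (K := tsupport (fun t => (φ (t / T) : ℂ)) ×ˢ tsupport cutoff)
      ((hasCompactSupport_comp_div hc hT).prod hasCompactSupport_cutoff) fun p hp => ?_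
    simp only [mem_prod, not_and_or] at hp
    simp only [hf, Function.uncurry_def]
    rcases hp with h | h
    · have := image_eq_zero_of_notMem_tsupport h
      rw [this, zero_mul]
    · rw [image_eq_zero_of_notMem_tsupport h]; ring
  have hswap := integral_integral_swap_of_hasCompactSupport (μ := volume) (ν := volume) hcont hsupp
  have h1 : dualTerm φ b T m = ∫ t, ∫ v, f t v := by
    simp only [dualTerm, oscIntegral, hf, integral_const_mul]
  rw [h1, hswap]
  congr 1; ext v
  rw [← integral_comp_div_mul_cexp hφ hc hT, ← integral_mul_const]
  congr 1; ext t
  have : cexp ((1 / 2 - b + t * I) * v) = cexp (t * v * I) * cexp ((1 / 2 - b) * v) := by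
    rw [← Complex.exp_add]; congr 1; ring
  simp only [hf]
  rw [this]
  ring

/-- Write `e^v = 1 + v + O(v²)` for `|v| < 1`. The constant term contributes `e(-m)`, which is `1`
because `m` is an integer, the linear term is the model phase, and the remainder costs `O(|m| v²)`.
The amplitude differs from `1` by `O(|v|)`. -/
lemma norm_phase_sub_phase_le {b : ℂ} (hb : ‖b‖ ≤ 1 / 4) (m : ℤ) (v : ℝ) :
    ‖cutoff v * cexp ((1 / 2 - b) * v) * cexp (-(2 * Real.pi * m * Real.exp v : ℝ) * I) -
      cexp (-(2 * Real.pi * m * v : ℝ) * I)‖ ≤ 8 * |v| + 7 * |(m : ℝ)| * v ^ 2 := by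
  rcases le_or_gt 1 |v| with hv | hv
  · rw [cutoff_eq_zero hv, zero_mul, zero_mul, zero_sub, norm_neg, norm_cexp_neg_ofReal_mul_I]
    have : 0 ≤ 7 * |(m : ℝ)| * v ^ 2 := by positivity
    linarith
  set A : ℂ := cutoff v * cexp ((1 / 2 - b) * v) with hA
  set x : ℝ := 2 * Real.pi * m * (Real.exp v - 1 - v) with hx
  have hfac : cexp (-(2 * Real.pi * m * Real.exp v : ℝ) * I) =
      cexp (-(2 * Real.pi * m * v : ℝ) * I) * cexp (-(x : ℂ) * I) := by
    have hper : cexp (-(((m : ℤ) : ℂ) * (2 * Real.pi * I))) = 1 := by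
      rw [Complex.exp_neg, Complex.exp_int_mul_two_pi_mul_I, inv_one]
    rw [← Complex.exp_add, ← mul_one (cexp (_ + _)), ← hper, ← Complex.exp_add]
    congr 1
    rw [hx]
    push_cast
    ring
  have hv1 : ‖(v : ℂ)‖ = |v| := by simp
  have hc : ‖(1 / 2 - b) * (v : ℂ)‖ ≤ |v| := by
    rw [norm_mul, hv1]
    refine mul_le_of_le_one_left (abs_nonneg v) ?_
    calc ‖1 / 2 - b‖ ≤ ‖(1 / 2 : ℂ)‖ + ‖b‖ := norm_sub_le _ _
      _ ≤ 1 := by norm_num; linarith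
  have he1 : ‖cexp ((1 / 2 - b) * v) - 1‖ ≤ 2 * |v| :=
    (Complex.norm_exp_sub_one_le (hc.trans hv.le)).trans (by linarith)
  have he2 : ‖cexp ((1 / 2 - b) * v)‖ ≤ 3 := by
    calc ‖cexp ((1 / 2 - b) * v)‖ = ‖(cexp ((1 / 2 - b) * v) - 1) + 1‖ := by rw [sub_add_cancel]
      _ ≤ ‖cexp ((1 / 2 - b) * v) - 1‖ + ‖(1 : ℂ)‖ := norm_add_le _ _
      _ ≤ 3 := by rw [norm_one]; linarith
  have hcut : ‖cutoff v - 1‖ ≤ 2 * |v| := by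
    rcases le_or_gt |v| (1 / 2) with h | h
    · rw [cutoff_eq_one h, sub_self, norm_zero]; positivity
    · linarith [norm_cutoff_sub_one_le v]
  have hA1 : ‖A - 1‖ ≤ 8 * |v| := by
    have : A - 1 = (cutoff v - 1) * cexp ((1 / 2 - b) * v) + (cexp ((1 / 2 - b) * v) - 1) := by
      rw [hA]; ring
    rw [this]
    refine (norm_add_le _ _).trans ?_
    rw [norm_mul]
    nlinarith [mul_le_mul hcut he2 (norm_nonneg _) (by positivity)]
  have hB1 : ‖cexp (-(x : ℂ) * I) - 1‖ ≤ 7 * |(m : ℝ)| * v ^ 2 := by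
    have h1 : ‖cexp (I * ((-x : ℝ) : ℂ)) - 1‖ ≤ ‖-x‖ := Real.norm_exp_I_mul_ofReal_sub_one_le
    rw [norm_neg, Real.norm_eq_abs, ofReal_neg, mul_comm I] at h1
    refine h1.trans ?_
    rw [hx, abs_mul, abs_mul, abs_of_pos Real.two_pi_pos]
    have h2 := Real.abs_exp_sub_one_sub_id_le hv.le
    have h3 : 2 * Real.pi ≤ 7 := by linarith [Real.pi_lt_d2]
    gcongr
  have : A * cexp (-(2 * Real.pi * m * Real.exp v : ℝ) * I) - cexp (-(2 * Real.pi * m * v : ℝ) * I) =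
      cexp (-(2 * Real.pi * m * v : ℝ) * I) *
        ((A - 1) * cexp (-(x : ℂ) * I) + (cexp (-(x : ℂ) * I) - 1)) := by
    rw [hfac]; ring
  rw [this, norm_mul, norm_cexp_neg_ofReal_mul_I, one_mul]
  refine (norm_add_le _ _).trans ?_
  rw [norm_mul, norm_cexp_neg_ofReal_mul_I, mul_one]
  exact add_le_add hA1 hB1

/-- The pointwise error `8|v| + 7|m| v²` is integrated against the weight of scale `1/T`. Its first
two absolute moments, `M₁` and `M₂` up to scaling, give the two terms. -/
lemma exists_norm_dualTerm_sub_le {φ : ℝ → ℝ} (hφ : ContDiff ℝ ∞ φ) (hc : HasCompactSupport φ) :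
    ∃ C, 0 ≤ C ∧ ∀ b : ℂ, ‖b‖ ≤ 1 / 4 → ∀ T : ℝ, 0 < T → ∀ m : ℤ,
      ‖dualTerm φ b T m - 2 * Real.pi * φ (2 * Real.pi * m / T)‖ ≤ C * (1 / T + |(m : ℝ)| / T ^ 2) := by
  set Ψ := invFourier φ hφ hc with hΨ
  set M₁ := ∫ u : ℝ, ‖u‖ ^ 1 * ‖Ψ u‖
  set M₂ := ∫ u : ℝ, ‖u‖ ^ 2 * ‖Ψ u‖
  have hM₁ : 0 ≤ M₁ := integral_nonneg fun u => by positivity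
  have hM₂ : 0 ≤ M₂ := integral_nonneg fun u => by positivity
  have hi₁ : Integrable fun u : ℝ => ‖u‖ ^ 1 * ‖Ψ u‖ := Ψ.integrable_pow_mul volume 1
  have hi₂ : Integrable fun u : ℝ => ‖u‖ ^ 2 * ‖Ψ u‖ := Ψ.integrable_pow_mul volume 2
  refine ⟨8 * (2 * Real.pi) ^ 2 * M₁ + 7 * (2 * Real.pi) ^ 3 * M₂, by positivity,
    fun b hb T hT m => ?_⟩
  have hcomp : Continuous fun v : ℝ => Ψ (T * v / (2 * Real.pi)) :=
    Ψ.continuous.comp (by fun_prop)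
  have hΨi : Integrable fun v : ℝ => (T : ℂ) * Ψ (T * v / (2 * Real.pi)) := by
    have := (Ψ.integrable (μ := volume)).comp_mul_left' (R := T / (2 * Real.pi)) (by positivity)
    refine (this.const_mul (T : ℂ)).congr (Eventually.of_forall fun v => ?_)
    simp only
    congr 2; ring
  have hcut := contDiff_cutoff.continuous
  rw [dualTerm_eq_integral hφ hc hT, ← integral_invFourier_mul_cexp hφ hc hT]
  have hI1 : Integrable fun v : ℝ => (T * Ψ (T * v / (2 * Real.pi))) *
      (cutoff v * cexp ((1 / 2 - b) * v) * cexp (-(2 * Real.pi * m * Real.exp v : ℝ) * I)) :=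
    Continuous.integrable_of_hasCompactSupport (by fun_prop)
      hasCompactSupport_cutoff.mul_right.mul_right.mul_left
  have hI2 : Integrable fun v : ℝ => (T * Ψ (T * v / (2 * Real.pi))) *
      cexp (-(2 * Real.pi * m * v : ℝ) * I) := by
    refine hΨi.norm.mono' (by fun_prop) (Eventually.of_forall fun v => ?_)
    rw [norm_mul, norm_cexp_neg_ofReal_mul_I, mul_one]
  rw [← integral_sub hI1 hI2]
  have hscale := Measure.integral_comp_mul_left (fun u : ℝ =>
    8 * (2 * Real.pi) * (‖u‖ ^ 1 * ‖Ψ u‖) +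
      7 * |(m : ℝ)| * (2 * Real.pi) ^ 2 / T * (‖u‖ ^ 2 * ‖Ψ u‖)) (T / (2 * Real.pi))
  have hpos : 0 < T / (2 * Real.pi) := by positivity
  have hi₁₂ := (hi₁.const_mul (8 * (2 * Real.pi))).add
      (hi₂.const_mul (7 * |(m : ℝ)| * (2 * Real.pi) ^ 2 / T))
  have hbound : ∀ v : ℝ, ‖(T * Ψ (T * v / (2 * Real.pi))) *
      (cutoff v * cexp ((1 / 2 - b) * v) * cexp (-(2 * Real.pi * m * Real.exp v : ℝ) * I)) -
      (T * Ψ (T * v / (2 * Real.pi))) * cexp (-(2 * Real.pi * m * v : ℝ) * I)‖ ≤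
      8 * (2 * Real.pi) * (‖T / (2 * Real.pi) * v‖ ^ 1 * ‖Ψ (T / (2 * Real.pi) * v)‖) +
      7 * |(m : ℝ)| * (2 * Real.pi) ^ 2 / T *
        (‖T / (2 * Real.pi) * v‖ ^ 2 * ‖Ψ (T / (2 * Real.pi) * v)‖) := by
    intro v
    rw [← mul_sub, norm_mul, norm_mul, norm_real, Real.norm_of_nonneg hT.le]
    refine (mul_le_mul_of_nonneg_left (norm_phase_sub_phase_le hb m v) (by positivity)).trans
      (le_of_eq ?_)
    rw [show T * v / (2 * Real.pi) = T / (2 * Real.pi) * v by ring, norm_mul,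
      Real.norm_of_nonneg hpos.le, Real.norm_eq_abs, ← sq_abs v]
    field_simp
  refine (norm_integral_le_of_norm_le (hi₁₂.comp_mul_left' hpos.ne')
    (Eventually.of_forall hbound)).trans ?_
  refine (le_of_eq hscale).trans ?_
  rw [abs_of_pos (inv_pos.mpr hpos), integral_add (hi₁.const_mul _) (hi₂.const_mul _),
    integral_const_mul, integral_const_mul, smul_eq_mul]
  change (T / (2 * Real.pi))⁻¹ * (8 * (2 * Real.pi) * M₁ +
    7 * |(m : ℝ)| * (2 * Real.pi) ^ 2 / T * M₂) ≤ _
  have e : (T / (2 * Real.pi))⁻¹ * (8 * (2 * Real.pi) * M₁ +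
      7 * |(m : ℝ)| * (2 * Real.pi) ^ 2 / T * M₂) =
      8 * (2 * Real.pi) ^ 2 * M₁ * (1 / T) + 7 * (2 * Real.pi) ^ 3 * M₂ * (|(m : ℝ)| / T ^ 2) := by
    field_simp
  rw [e]
  have p1 : 0 ≤ 8 * (2 * Real.pi) ^ 2 * M₁ * (|(m : ℝ)| / T ^ 2) := by positivity
  have p2 : 0 ≤ 7 * (2 * Real.pi) ^ 3 * M₂ * (1 / T) := by positivity
  linarith

lemma exists_support_bounds {φ : ℝ → ℝ} (hc : HasCompactSupport φ) (hp : tsupport φ ⊆ Ioi 0) :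
    ∃ c₀ c₁ : ℝ, 0 < c₀ ∧ 0 < c₁ ∧ ∀ x, φ x ≠ 0 → c₀ ≤ x ∧ x ≤ c₁ := by
  rcases (tsupport φ).eq_empty_or_nonempty with h | h
  · refine ⟨1, 1, one_pos, one_pos, fun x hx => ?_⟩
    have := subset_tsupport φ hx
    simp [h] at this
  · obtain ⟨a, ha, hal⟩ := IsCompact.exists_isLeast hc h
    obtain ⟨b, hb, hbl⟩ := IsCompact.exists_isGreatest hc h
    exact ⟨a, b, hp ha, hp hb, fun x hx =>
      ⟨hal (subset_tsupport φ hx), hbl (subset_tsupport φ hx)⟩⟩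

lemma abs_re_shift_le {b : ℂ} (hb : ‖b‖ ≤ 1 / 4) (t : ℝ) : |(1 / 2 - b + t * I).re| ≤ 1 := by
  have h := (abs_re_le_norm b).trans hb
  rw [abs_le] at h ⊢
  simp only [add_re, sub_re, mul_re, ofReal_re, I_re, ofReal_im, I_im, mul_zero, mul_one, sub_self,
    add_zero, one_div, inv_re, normSq_ofNat, re_ofNat]
  constructor <;> linarith [h.1, h.2]

lemma norm_shift_le {b : ℂ} (hb : ‖b‖ ≤ 1 / 4) (t : ℝ) : ‖1 / 2 - b + t * I‖ ≤ 1 + |t| := by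
  refine (norm_add_le _ _).trans (add_le_add ((norm_sub_le _ _).trans ?_) (by simp))
  norm_num
  linarith

lemma integral_norm_comp_div (φ : ℝ → ℝ) {T : ℝ} (hT : 0 < T) :
    ∫ t, ‖(φ (t / T) : ℂ)‖ = T * ∫ u, |φ u| := by
  have := Measure.integral_comp_div (fun u => |φ u|) T
  simpa [abs_of_pos hT] using this

/-- On the support of `φ(t/T)` the exponent `c` has size `O(T)`, so each integration by parts in `v`
gains a factor `T/|m|`. -/
lemma exists_norm_dualTerm_mul_pow_le {φ : ℝ → ℝ} (hφ : Continuous φ)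
    (hc : HasCompactSupport φ) (hp : tsupport φ ⊆ Ioi 0) (K : ℕ) :
    ∃ C, 0 ≤ C ∧ ∀ b : ℂ, ‖b‖ ≤ 1 / 4 → ∀ T : ℝ, 1 ≤ T → ∀ m : ℝ,
      ‖dualTerm φ b T m‖ * |m| ^ K ≤ C * T ^ (K + 1) := by
  obtain ⟨c₀, c₁, h₀, h₁, hsupp⟩ := exists_support_bounds hc hp
  obtain ⟨C, hC, hosc⟩ := exists_norm_oscIntegral_mul_pow_le contDiff_cutoff
    hasCompactSupport_cutoff 1 K
  refine ⟨C * (2 + c₁) ^ K * ∫ u, |φ u|,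
    mul_nonneg (by positivity) (integral_nonneg fun u => abs_nonneg _), fun b hb T hT m => ?_⟩
  have hT0 : 0 < T := by linarith
  have hkey : ‖(|m| ^ K : ℝ) * dualTerm φ b T m‖ ≤
      ∫ t, ‖(φ (t / T) : ℂ)‖ * (C * ((2 + c₁) * T) ^ K) := by
    rw [dualTerm, ← integral_const_mul]
    refine norm_integral_le_of_norm_le ((integrable_comp_div hφ hc hT0).norm.mul_const _)
      (Eventually.of_forall fun t => ?_)
    rw [norm_mul, norm_mul, norm_real, Real.norm_of_nonneg (by positivity)]
    by_cases ht : φ (t / T) = 0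
    · simp [ht]
    · obtain ⟨ht0, ht1⟩ := hsupp _ ht
      rw [div_le_iff₀ hT0] at ht1
      rw [le_div_iff₀ hT0] at ht0
      have htn : 0 ≤ t := le_trans (by positivity) ht0
      have h1 := hosc (1 / 2 - b + t * I) (abs_re_shift_le hb t) m
      have h2 := norm_shift_le hb t
      rw [abs_of_nonneg htn] at h2
      calc |m| ^ K * (‖(φ (t / T) : ℂ)‖ * ‖oscIntegral cutoff (1 / 2 - b + t * I) m‖)
          = ‖(φ (t / T) : ℂ)‖ * (‖oscIntegral cutoff (1 / 2 - b + t * I) m‖ * |m| ^ K) := by ring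
        _ ≤ ‖(φ (t / T) : ℂ)‖ * (C * (1 + ‖1 / 2 - b + t * I‖) ^ K) := by gcongr
        _ ≤ ‖(φ (t / T) : ℂ)‖ * (C * ((2 + c₁) * T) ^ K) := by
            gcongr
            nlinarith
  rw [norm_mul, norm_real, Real.norm_of_nonneg (by positivity), integral_mul_const,
    integral_norm_comp_div φ hT0, mul_comm] at hkey
  refine hkey.trans (le_of_eq ?_)
  rw [mul_pow]
  ring

lemma exists_norm_dualTerm_zero_le {φ : ℝ → ℝ} (hφ : Continuous φ)
    (hc : HasCompactSupport φ) (hp : tsupport φ ⊆ Ioi 0) (K : ℕ) :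
    ∃ C T₁, 0 ≤ C ∧ ∀ b : ℂ, ‖b‖ ≤ 1 / 4 → ∀ T : ℝ, 1 ≤ T → T₁ ≤ T →
      ‖dualTerm φ b T 0‖ ≤ C * T / T ^ K := by
  obtain ⟨c₀, c₁, h₀, h₁, hsupp⟩ := exists_support_bounds hc hp
  obtain ⟨C, hosc⟩ := exists_norm_oscIntegral_zero_mul_pow_le contDiff_cutoff
    hasCompactSupport_cutoff 1 K
  -- At frequency `0` the decay comes from `t ≥ c₀ T`. The threshold `1 / c₀` lets `c₀ T / 2` absorb
  -- the imaginary part of `b`.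
  refine ⟨|C| * (2 / c₀) ^ K * ∫ u, |φ u|, 1 / c₀,
    mul_nonneg (by positivity) (integral_nonneg fun u => abs_nonneg _), fun b hb T hT hT₁ => ?_⟩
  have hT0 : 0 < T := by linarith
  have hkey : ‖dualTerm φ b T 0‖ ≤ ∫ t, ‖(φ (t / T) : ℂ)‖ * (|C| * (2 / c₀ / T) ^ K) := by
    rw [dualTerm]
    refine norm_integral_le_of_norm_le ((integrable_comp_div hφ hc hT0).norm.mul_const _)
      (Eventually.of_forall fun t => ?_)
    rw [norm_mul]
    by_cases ht : φ (t / T) = 0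
    · simp [ht]
    · obtain ⟨ht0, ht1⟩ := hsupp _ ht
      rw [le_div_iff₀ hT0] at ht0
      rw [div_le_iff₀ h₀] at hT₁
      have hi := (abs_im_le_norm b).trans hb
      rw [abs_le] at hi
      have hlow : c₀ * T / 2 ≤ ‖1 / 2 - b + t * I‖ := by
        refine le_trans ?_ ((le_abs_self _).trans (abs_im_le_norm _))
        simp
        nlinarith [hi.1, hi.2]
      have h1 := hosc (1 / 2 - b + t * I) (abs_re_shift_le hb t)
      refine mul_le_mul_of_nonneg_left ?_ (norm_nonneg _)
      have hpos : 0 < c₀ * T / 2 := by positivity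
      have h2 : ‖oscIntegral cutoff (1 / 2 - b + t * I) 0‖ * (c₀ * T / 2) ^ K ≤ |C| := by
        refine le_trans ?_ (h1.trans (le_abs_self C))
        gcongr
      rw [← le_div_iff₀ (by positivity)] at h2
      refine h2.trans (le_of_eq ?_)
      rw [div_eq_mul_inv, ← inv_pow]
      congr 2
      field_simp
  rw [integral_mul_const, integral_norm_comp_div φ hT0] at hkey
  refine hkey.trans (le_of_eq ?_)
  rw [div_pow (2 / c₀) T]
  ring

/-- The dual term agrees with `2π φ(2πm/T)` at nonzero integers, with a summable error. -/
lemma exists_norm_dualTerm_sub_le_rpow {φ : ℝ → ℝ} (hφ : ContDiff ℝ ∞ φ)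
    (hc : HasCompactSupport φ) (hp : tsupport φ ⊆ Ioi 0) {δ : ℝ} (hδ : 0 < δ) :
    ∃ C, 0 ≤ C ∧ ∀ b : ℂ, ‖b‖ ≤ 1 / 4 → ∀ T : ℝ, 1 ≤ T → ∀ m : ℤ, m ≠ 0 →
      ‖dualTerm φ b T m - 2 * Real.pi * φ (2 * Real.pi * m / T)‖ ≤
        C * (T ^ (1 / 2 + δ) * |(m : ℝ)| ^ (-(3 / 2) : ℝ)) := by
  obtain ⟨C₁, hC₁, h₁⟩ := exists_norm_dualTerm_sub_le hφ hc
  -- For `|m| > T^{1+δ/3}`, the exponents balance when `δ + (δ/3)(K - 3/2) ≥ 2`, which this `K`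
  -- ensures.
  obtain ⟨K, hK⟩ := exists_nat_ge (3 / 2 + 6 / δ)
  obtain ⟨C₂, hC₂, h₂⟩ := exists_norm_dualTerm_mul_pow_le hφ.continuous hc hp K
  obtain ⟨c₀, c₁, hc₀, hc₁, hsupp⟩ := exists_support_bounds hc hp
  obtain ⟨M, hM⟩ := hφ.continuous.norm.bddAbove_range_of_hasCompactSupport hc.norm
  have hM' : ∀ x, |φ x| ≤ M := fun x => hM ⟨x, rfl⟩
  have hM0 : 0 ≤ M := (abs_nonneg _).trans (hM' 0)
  refine ⟨2 * C₁ + (C₂ + 2 * Real.pi * M * c₁ ^ K), by positivity, fun b hb T hT m hm => ?_⟩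
  have hT0 : 0 < T := by linarith
  set y : ℝ := |(m : ℝ)| with hy
  have hy1 : 1 ≤ y := by rw [hy]; exact_mod_cast Int.one_le_abs hm
  have hy0 : 0 < y := by linarith
  have hp1 : 0 ≤ T ^ (1 / 2 + δ) * y ^ (-(3 / 2) : ℝ) := by positivity
  rcases le_or_gt y (T ^ (1 + δ / 3)) with hle | hgt
  · have e1 : T⁻¹ ≤ T ^ (1 / 2 + δ) * y ^ (-(3 / 2) : ℝ) ∧
        y / T ^ 2 ≤ T ^ (1 / 2 + δ) * y ^ (-(3 / 2) : ℝ) := by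
      have hyy : y ^ (3 / 2 : ℝ) ≤ T ^ (3 / 2 + δ / 2) := by
        calc y ^ (3 / 2 : ℝ) ≤ (T ^ (1 + δ / 3)) ^ (3 / 2 : ℝ) := by gcongr
          _ = T ^ (3 / 2 + δ / 2) := by rw [← Real.rpow_mul hT0.le]; congr 1; ring
      have hfrac : T ^ (-1 + δ / 3) ≤ T ^ (1 / 2 + δ) * y ^ (-(3 / 2) : ℝ) := by
        rw [Real.rpow_neg hy0.le, ← div_eq_mul_inv, le_div_iff₀ (by positivity)]
        calc T ^ (-1 + δ / 3) * y ^ (3 / 2 : ℝ) ≤ T ^ (-1 + δ / 3) * T ^ (3 / 2 + δ / 2) := by gcongr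
          _ = T ^ (-1 + δ / 3 + (3 / 2 + δ / 2)) := (Real.rpow_add hT0 _ _).symm
          _ ≤ T ^ (1 / 2 + δ) := Real.rpow_le_rpow_of_exponent_le hT (by linarith)
      constructor
      · refine le_trans ?_ hfrac
        rw [← Real.rpow_neg_one]
        exact Real.rpow_le_rpow_of_exponent_le hT (by linarith)
      · refine le_trans ?_ hfrac
        rw [div_le_iff₀ (by positivity), ← Real.rpow_natCast T 2, ← Real.rpow_add hT0]
        refine hle.trans (le_of_eq ?_)
        congr 1; push_cast; ring
    have h3 := h₁ b hb T hT0 m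
    rw [← hy, one_div] at h3
    have q : 0 ≤ (C₂ + 2 * Real.pi * M * c₁ ^ K) * (T ^ (1 / 2 + δ) * y ^ (-(3 / 2) : ℝ)) := by
      positivity
    have h4 := mul_le_mul_of_nonneg_left (add_le_add e1.1 e1.2) hC₁
    linarith
  · have hpow : T ^ (K + 1) / y ^ K ≤ T ^ (1 / 2 + δ) * y ^ (-(3 / 2) : ℝ) := by
      rw [div_le_iff₀ (by positivity), ← Real.rpow_natCast, ← Real.rpow_natCast, mul_assoc,
        ← Real.rpow_add hy0]
      have hKr : 0 ≤ -(3 / 2) + (K : ℝ) := by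
        have : 0 < 6 / δ := by positivity
        linarith
      calc T ^ ((K + 1 : ℕ) : ℝ) ≤ T ^ (1 / 2 + δ + (1 + δ / 3) * (-(3 / 2) + K)) := by
            refine Real.rpow_le_rpow_of_exponent_le hT ?_
            push_cast
            have : 6 / δ ≤ -(3 / 2) + K := by linarith
            rw [div_le_iff₀ hδ] at this
            nlinarith
        _ = T ^ (1 / 2 + δ) * (T ^ (1 + δ / 3)) ^ (-(3 / 2) + (K : ℝ)) := by
            rw [Real.rpow_add hT0, Real.rpow_mul hT0.le]
        _ ≤ T ^ (1 / 2 + δ) * y ^ (-(3 / 2) + (K : ℝ)) := by gcongr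
    have hA : ‖dualTerm φ b T m‖ ≤ C₂ * (T ^ (K + 1) / y ^ K) := by
      rw [← mul_div_assoc, le_div_iff₀ (by positivity)]
      exact h₂ b hb T hT m
    -- A nonzero value of `φ` here forces `y ≤ c₁ T`, so the trivial bound `M` already fits under
    -- `(c₁ T / y)^K`.
    have hB : ‖(2 * Real.pi * φ (2 * Real.pi * m / T) : ℂ)‖ ≤
        2 * Real.pi * M * c₁ ^ K * (T ^ (K + 1) / y ^ K) := by
      by_cases h0 : φ (2 * Real.pi * m / T) = 0
      · rw [h0, ofReal_zero, mul_zero, norm_zero]; positivity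
      · obtain ⟨ha, hb'⟩ := hsupp _ h0
        have hyc : y ≤ c₁ * T := by
          have hmpos : 0 < (m : ℝ) := by
            by_contra hneg
            have : 2 * Real.pi * m / T ≤ 0 :=
              div_nonpos_of_nonpos_of_nonneg
                (mul_nonpos_of_nonneg_of_nonpos (by positivity) (not_lt.mp hneg)) hT0.le
            linarith
          rw [div_le_iff₀ hT0] at hb'
          rw [hy, abs_of_pos hmpos]
          nlinarith [Real.pi_gt_three]
        have hle1 : 1 ≤ c₁ ^ K * (T ^ (K + 1) / y ^ K) := by
          rw [← mul_div_assoc, le_div_iff₀ (by positivity), one_mul]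
          calc y ^ K ≤ (c₁ * T) ^ K := by gcongr
            _ = c₁ ^ K * T ^ K := mul_pow _ _ _
            _ ≤ c₁ ^ K * T ^ (K + 1) := by
                gcongr
                exact Nat.le_succ K
        rw [norm_mul, norm_mul, norm_real, norm_real, Real.norm_of_nonneg Real.pi_pos.le,
          Real.norm_eq_abs, RCLike.norm_ofNat, mul_assoc _ (c₁ ^ K)]
        calc 2 * Real.pi * |φ (2 * Real.pi * m / T)| ≤ 2 * Real.pi * M * 1 := by
              rw [mul_one]; gcongr; exact hM' _
          _ ≤ _ := by gcongr
    refine (norm_sub_le _ _).trans ((add_le_add hA hB).trans ?_)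
    rw [← add_mul]
    have q : 0 ≤ 2 * C₁ * (T ^ (1 / 2 + δ) * y ^ (-(3 / 2) : ℝ)) := by positivity
    have := mul_le_mul_of_nonneg_left hpow
      (by positivity : 0 ≤ C₂ + 2 * Real.pi * M * c₁ ^ K)
    linarith

/-! ### Poisson summation and the sum of the dual terms. -/

/-- The function `x ↦ ψ(log (x / q)) x^c` on `(0, ∞)`, extended by zero. -/
noncomputable def localizedPower (q : ℝ) (c : ℂ) (x : ℝ) : ℂ :=
  if 0 < x then cutoff (Real.log (x / q)) * (x : ℂ) ^ c else 0

lemma localizedPower_eq_zero_of_le {q x : ℝ} (hq : 0 < q) (c : ℂ) (hx : x ≤ q * Real.exp (-1)) :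
    localizedPower q c x = 0 := by
  rw [localizedPower]
  split_ifs with h
  · rw [cutoff_eq_zero, zero_mul]
    have : Real.log (x / q) ≤ -1 := by
      rw [Real.log_le_iff_le_exp (by positivity), div_le_iff₀ hq, mul_comm]
      exact hx
    rw [le_abs]
    right; linarith
  · rfl

lemma cutoff_log_eq_zero_of_le {q x : ℝ} (hq : 0 < q) (hx : 3 * q ≤ x) :
    cutoff (Real.log (x / q)) = 0 := by
  refine cutoff_eq_zero (le_trans ?_ (le_abs_self _))
  rw [Real.le_log_iff_exp_le (div_pos (by linarith) hq), le_div_iff₀ hq]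
  nlinarith [Real.exp_one_lt_d9]

lemma localizedPower_eq_zero_of_ge {q x : ℝ} (hq : 0 < q) (c : ℂ) (hx : 3 * q ≤ x) :
    localizedPower q c x = 0 := by
  rw [localizedPower, cutoff_log_eq_zero_of_le hq hx, zero_mul, ite_self]

lemma continuous_localizedPower {q : ℝ} (hq : 0 < q) (c : ℂ) :
    Continuous (localizedPower q c) := by
  rw [continuous_iff_continuousAt]
  intro x
  have hq1 : 0 < q * Real.exp (-1) := by positivity
  rcases lt_or_ge 0 x with hx | hx
  · have h : ContinuousAt (fun x : ℝ => cutoff (Real.log (x / q)) * (x : ℂ) ^ c) x := by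
      refine ContinuousAt.mul (ContinuousAt.comp (g := cutoff)
        contDiff_cutoff.continuous.continuousAt ?_) (hasDerivAt_ofReal_cpow_pos c hx).continuousAt
      exact (continuousAt_id.div_const q).log (by simp only [id]; positivity)
    refine h.congr ?_
    filter_upwards [Ioi_mem_nhds hx] with y hy
    rw [localizedPower, if_pos (mem_Ioi.mp hy)]
  · refine (continuousAt_const (y := (0 : ℂ))).congr ?_
    filter_upwards [Iio_mem_nhds (hx.trans_lt hq1)] with y hy
    exact (localizedPower_eq_zero_of_le hq c (le_of_lt hy)).symm

lemma hasCompactSupport_localizedPower {q : ℝ} (hq : 0 < q) (c : ℂ) :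
    HasCompactSupport (localizedPower q c) := by
  refine HasCompactSupport.intro (isCompact_Icc (a := 0) (b := 3 * q)) fun x hx => ?_
  rw [mem_Icc, not_and_or, not_le, not_le] at hx
  rcases hx with h | h
  · rw [localizedPower, if_neg h.le.not_gt]
  · exact localizedPower_eq_zero_of_ge hq c h.le

/-- The substitution `x = q e^v` turns the additive character into the exponential phase and
multiplies the frequency by `q`. -/
lemma fourier_localizedPower {q : ℝ} (hq : 0 < q) (c : ℂ) (ξ : ℝ) :
    𝓕 (localizedPower q c) ξ = (q : ℂ) ^ (c + 1) * oscIntegral cutoff (c + 1) (ξ * q) := by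
  have hqC : (q : ℂ) ≠ 0 := by exact_mod_cast hq.ne'
  rw [Real.fourier_eq']
  set h : ℝ → ℂ := fun x => cexp (((-2 * Real.pi * inner ℝ x ξ : ℝ) : ℂ) * I) •
    localizedPower q c x with hh
  have h1 : ∫ x, h x = ∫ x in Ioi (0 : ℝ), h x := by
    refine (setIntegral_eq_integral_of_forall_compl_eq_zero fun x hx => ?_).symm
    rw [hh]
    simp only
    rw [localizedPower, if_neg (show ¬0 < x from hx), smul_zero]
  rw [h1, integral_Ioi_zero_eq_integral_rexp,
    ← integral_add_right_eq_self (fun v : ℝ => (Real.exp v : ℂ) * h (Real.exp v)) (Real.log q),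
    oscIntegral, ← integral_const_mul]
  congr 1; ext v
  have e1 : Real.exp (v + Real.log q) = q * Real.exp v := by
    rw [Real.exp_add, Real.exp_log hq, mul_comm]
  rw [e1, hh]
  simp only
  rw [localizedPower, if_pos (by positivity), mul_div_cancel_left₀ _ hq.ne', Real.log_exp,
    ofReal_mul, mul_cpow_ofReal_nonneg hq.le (Real.exp_pos v).le, ofReal_rexp_cpow,
    cpow_add _ _ hqC, cpow_one, add_mul, Complex.exp_add, one_mul, ofReal_exp]
  have e2 : (-2 * Real.pi * inner ℝ (q * Real.exp v) ξ : ℝ) =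
      -(2 * Real.pi * (ξ * q) * Real.exp v) := by
    simp only [RCLike.inner_apply, conj_trivial]; ring
  rw [e2, smul_eq_mul, ofReal_neg]
  ring

lemma exists_norm_oscIntegral_cutoff_le : ∃ C, 0 ≤ C ∧ ∀ c : ℂ, |c.re| ≤ 1 → ∀ m : ℝ,
    ‖oscIntegral cutoff c m‖ * |m| ^ 2 ≤ C * (1 + ‖c‖) ^ 2 :=
  exists_norm_oscIntegral_mul_pow_le contDiff_cutoff hasCompactSupport_cutoff 1 2

lemma summable_int_abs_rpow_neg_two : Summable fun j : ℤ => |(j : ℝ)| ^ (-2 : ℝ) :=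
  Real.summable_abs_int_rpow one_lt_two

lemma abs_int_rpow_neg_two (j : ℤ) : |(j : ℝ)| ^ (-2 : ℝ) = (|(j : ℝ)| ^ 2)⁻¹ := by
  rw [Real.rpow_neg (abs_nonneg _)]; norm_num

/-- Poisson summation for a localized power. -/
lemma sum_cutoff_mul_cpow {q : ℝ} (hq : 1 ≤ q) {c : ℂ} (hc : |(c + 1).re| ≤ 1) {L : ℕ}
    (hL : 3 * q ≤ L) :
    ∑ l ∈ Finset.Icc 1 L, cutoff (Real.log (l / q)) * (l : ℂ) ^ c =
      (q : ℂ) ^ (c + 1) * ∑' j : ℤ, oscIntegral cutoff (c + 1) (j * q) := by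
  have hq0 : 0 < q := by linarith
  have hsum : Summable fun j : ℤ => 𝓕 (localizedPower q c) j := by
    simp_rw [fourier_localizedPower hq0]
    refine Summable.mul_left _ ?_
    obtain ⟨C, hC, hosc⟩ := exists_norm_oscIntegral_cutoff_le
    refine Summable.of_norm_bounded_eventually
      (summable_int_abs_rpow_neg_two.mul_left (C * (1 + ‖c + 1‖) ^ 2)) ?_
    filter_upwards [eventually_cofinite_ne (0 : ℤ)] with j hj
    have hj1 : 1 ≤ |(j : ℝ)| := by exact_mod_cast Int.one_le_abs hj
    have h1 := hosc (c + 1) hc (j * q)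
    rw [abs_int_rpow_neg_two, ← div_eq_mul_inv, le_div_iff₀ (by positivity)]
    refine le_trans (mul_le_mul_of_nonneg_left (pow_le_pow_left₀ (abs_nonneg _) ?_ 2)
      (norm_nonneg _)) h1
    rw [abs_mul, abs_of_pos hq0]
    exact le_mul_of_one_le_right (abs_nonneg _) hq
  have hO : localizedPower q c =O[cocompact ℝ] fun x : ℝ => |x| ^ (-2 : ℝ) := by
    have := (hasCompactSupport_localizedPower hq0 c)
    rw [hasCompactSupport_iff_eventuallyEq, coclosedCompact_eq_cocompact] at this
    exact this.trans_isBigO (Asymptotics.isBigO_zero _ _)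
  have hP := Real.tsum_eq_tsum_fourier_of_rpow_decay_of_summable
    (continuous_localizedPower hq0 c) one_lt_two hO hsum 0
  simp only [zero_add, fourier_localizedPower hq0] at hP
  rw [← tsum_mul_left]
  have hR : ∑' j : ℤ, (q : ℂ) ^ (c + 1) * oscIntegral cutoff (c + 1) (j * q) *
      fourier j ((0 : ℝ) : UnitAddCircle) =
      ∑' j : ℤ, (q : ℂ) ^ (c + 1) * oscIntegral cutoff (c + 1) (j * q) := by
    refine tsum_congr fun j => ?_
    rw [QuotientAddGroup.mk_zero, fourier_eval_zero, mul_one]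
  -- The support lies in `0 < x < 3q ≤ L`, since `e < 3`, so the sum up to `L` is the full sum over
  -- the integers.
  rw [← hR, ← hP, tsum_eq_sum (s := (Finset.Icc 1 L).map Nat.castEmbedding), Finset.sum_map]
  · refine Finset.sum_congr rfl fun l hl => ?_
    have hl1 : (0 : ℝ) < l := by exact_mod_cast (Finset.mem_Icc.mp hl).1
    simp [localizedPower, hl1]
  · intro l hl
    by_contra hne
    have hl0 : 0 < (l : ℝ) := by
      by_contra h
      exact hne (by rw [localizedPower, if_neg h])
    have hl1 : (l : ℝ) < 3 * q := by
      by_contra h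
      exact hne (localizedPower_eq_zero_of_ge hq0 c (not_lt.mp h))
    have hl0' : 0 < l := by exact_mod_cast hl0
    lift l to ℕ using hl0'.le
    refine hl (Finset.mem_map.mpr ⟨l, Finset.mem_Icc.mpr ⟨by exact_mod_cast hl0', ?_⟩, rfl⟩)
    have : (l : ℝ) < L := by
      refine lt_of_lt_of_le ?_ hL
      exact_mod_cast hl1
    exact_mod_cast this.le

lemma continuous_oscIntegral_shift {b : ℂ} (hb : ‖b‖ ≤ 1 / 4) (m : ℝ) :
    Continuous fun t : ℝ => oscIntegral cutoff (1 / 2 - b + t * I) m := by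
  have hcut := contDiff_cutoff.continuous
  refine continuous_of_dominated (bound := fun v => ‖cutoff v‖ * Real.exp (1 * |v|))
    (fun t => (continuous_oscIntegrand hcut _ m).aestronglyMeasurable) (fun t => ?_)
    (Continuous.integrable_of_hasCompactSupport (by fun_prop)
      hasCompactSupport_cutoff.norm.mul_right)
    (Eventually.of_forall fun v => by fun_prop)
  refine Eventually.of_forall fun v => ?_
  rw [norm_mul, norm_mul, norm_cexp_neg_ofReal_mul_I, mul_one, Complex.norm_exp]
  gcongr
  have hre := abs_re_shift_le hb t
  generalize 1 / 2 - b + t * I = c at hre ⊢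
  simp only [mul_re, ofReal_re, ofReal_im, mul_zero, sub_zero]
  calc c.re * v ≤ |c.re * v| := le_abs_self _
    _ = |c.re| * |v| := abs_mul _ _
    _ ≤ 1 * |v| := by gcongr

/-- The smoothed dual form of the sum over `l`: Poisson summation, averaged over `t`. -/
lemma integral_sum_cutoff_eq {φ : ℝ → ℝ} (hφ : Continuous φ) (hc : HasCompactSupport φ)
    (hp : tsupport φ ⊆ Ioi 0) {b : ℂ} (hb : ‖b‖ ≤ 1 / 4) {T : ℝ} (hT : 0 < T) {q : ℝ}
    (hq : 1 ≤ q) {L : ℕ} (hL : 3 * q ≤ L) :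
    (Summable fun j : ℤ => dualTerm φ b T (j * q)) ∧
    ∫ t : ℝ, (φ (t / T) : ℂ) * ((q : ℂ) ^ (-(1 / 2 + t * I)) *
      ∑ l ∈ Finset.Icc 1 L, cutoff (Real.log (l / q)) * (l : ℂ) ^ (-(1 / 2 - t * I + b))) =
      (q : ℂ) ^ (-b) * ∑' j : ℤ, dualTerm φ b T (j * q) := by
  have hq0 : 0 < q := by linarith
  have hqC : (q : ℂ) ≠ 0 := by exact_mod_cast hq0.ne'
  obtain ⟨c₀, c₁, h₀, h₁, hsupp⟩ := exists_support_bounds hc hp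
  obtain ⟨C, hC, hosc⟩ := exists_norm_oscIntegral_cutoff_le
  set F : ℤ → ℝ → ℂ := fun j t =>
    (φ (t / T) : ℂ) * oscIntegral cutoff (1 / 2 - b + t * I) (j * q) with hF
  have hFi : ∀ j, Integrable (F j) := fun j =>
    Continuous.integrable_of_hasCompactSupport
      ((by fun_prop : Continuous fun t : ℝ => (φ (t / T) : ℂ)).mul
        (continuous_oscIntegral_shift hb _)) (hasCompactSupport_comp_div hc hT).mul_right
  have hFn : Summable fun j => ∫ t, ‖F j t‖ := by
    refine Summable.of_norm_bounded_eventually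
      (summable_int_abs_rpow_neg_two.mul_left
        (∫ t, ‖(φ (t / T) : ℂ)‖ * (C * (2 + c₁ * T) ^ 2))) ?_
    filter_upwards [eventually_cofinite_ne (0 : ℤ)] with j hj
    have hj1 : 1 ≤ |(j : ℝ)| := by exact_mod_cast Int.one_le_abs hj
    rw [Real.norm_of_nonneg (integral_nonneg fun t => norm_nonneg _), ← integral_mul_const]
    refine integral_mono (hFi j).norm (((integrable_comp_div hφ hc hT).norm.mul_const _).mul_const _)
      fun t => ?_
    simp only [hF]
    rw [norm_mul, mul_assoc]
    by_cases ht : φ (t / T) = 0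
    · simp [ht]
    · obtain ⟨ht0, ht1⟩ := hsupp _ ht
      rw [div_le_iff₀ hT] at ht1
      rw [le_div_iff₀ hT] at ht0
      have htn : 0 ≤ t := le_trans (by positivity) ht0
      have h1 := hosc (1 / 2 - b + t * I) (abs_re_shift_le hb t) (j * q)
      have h2 := norm_shift_le hb t
      rw [abs_of_nonneg htn] at h2
      gcongr
      rw [abs_int_rpow_neg_two, ← div_eq_mul_inv, le_div_iff₀ (by positivity)]
      calc ‖oscIntegral cutoff (1 / 2 - b + t * I) (j * q)‖ * |(j : ℝ)| ^ 2
          ≤ ‖oscIntegral cutoff (1 / 2 - b + t * I) (j * q)‖ * |(j : ℝ) * q| ^ 2 := by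
            refine mul_le_mul_of_nonneg_left (pow_le_pow_left₀ (abs_nonneg _) ?_ 2)
              (norm_nonneg _)
            rw [abs_mul, abs_of_pos hq0]
            exact le_mul_of_one_le_right (abs_nonneg _) hq
        _ ≤ C * (1 + ‖1 / 2 - b + t * I‖) ^ 2 := h1
        _ ≤ C * (2 + c₁ * T) ^ 2 :=
            mul_le_mul_of_nonneg_left (pow_le_pow_left₀ (by positivity) (by linarith) 2) hC
  have hHS := hasSum_integral_of_summable_integral_norm hFi hFn
  refine ⟨hHS.summable, ?_⟩
  change _ = (q : ℂ) ^ (-b) * ∑' j : ℤ, ∫ t, F j t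
  rw [hHS.tsum_eq, ← integral_const_mul]
  congr 1; ext t
  have e1 : -(1 / 2 - t * I + b) + 1 = 1 / 2 - b + t * I := by ring
  rw [sum_cutoff_mul_cpow hq (by rw [e1]; exact abs_re_shift_le hb t) hL, e1]
  simp only [hF]
  rw [tsum_mul_left, ← mul_assoc ((q : ℂ) ^ _), ← cpow_add _ _ hqC]
  -- The oscillation `q^{-it}` cancels the `q^{it}` created by Poisson summation, which leaves a
  -- factor free of `t`.
  rw [show -(1 / 2 + (t : ℂ) * I) + (1 / 2 - b + t * I) = -b by ring]
  ring

/-- Evaluation of the dual sum. -/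
lemma exists_norm_tsum_dualTerm_sub_le {φ : ℝ → ℝ} (hφ : ContDiff ℝ ∞ φ)
    (hc : HasCompactSupport φ) (hp : tsupport φ ⊆ Ioi 0) {δ : ℝ} (hδ : 0 < δ) (K : ℕ) :
    ∃ C T₁, 0 ≤ C ∧ ∀ b : ℂ, ‖b‖ ≤ 1 / 4 → ∀ T : ℝ, 1 ≤ T → T₁ ≤ T → ∀ q : ℕ, 1 ≤ q →
      ‖∑' j : ℤ, dualTerm φ b T (j * q) -
        2 * Real.pi * ∑' j : ℕ, (φ (2 * Real.pi * q * (j + 1) / T) : ℂ)‖ ≤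
        C * (T ^ (1 / 2 + δ) * (q : ℝ) ^ (-(3 / 2) : ℝ) + T / T ^ K) := by
  obtain ⟨C₁, T₁, hC₁, h₁⟩ := exists_norm_dualTerm_zero_le hφ.continuous hc hp K
  obtain ⟨C₂, hC₂, h₂⟩ := exists_norm_dualTerm_sub_le_rpow hφ hc hp hδ
  obtain ⟨c₀, c₁, hc₀, hc₁, hsupp⟩ := exists_support_bounds hc hp
  have hφ0 : ∀ x ≤ 0, φ x = 0 := fun x hx => by
    by_contra h
    linarith [(hsupp x h).1]
  have hZ : Summable fun j : ℤ => |(j : ℝ)| ^ (-(3 / 2) : ℝ) :=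
    Real.summable_abs_int_rpow (by norm_num)
  set Z := ∑' j : ℤ, |(j : ℝ)| ^ (-(3 / 2) : ℝ) with hZdef
  have hZ0 : 0 ≤ Z := tsum_nonneg fun j => by positivity
  refine ⟨C₁ + C₂ * Z, T₁, by positivity, fun b hb T hT hTT q hq => ?_⟩
  have hT0 : 0 < T := by linarith
  have hqr : (1 : ℝ) ≤ q := by exact_mod_cast hq
  obtain ⟨L, hL⟩ := exists_nat_ge (3 * (q : ℝ))
  have hsD := (integral_sum_cutoff_eq hφ.continuous hc hp hb hT0 hqr hL).1
  set P : ℤ → ℂ := fun j => 2 * Real.pi * (φ (2 * Real.pi * q * j / T) : ℂ) with hP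
  have hinj : Function.Injective fun n : ℕ => ((n : ℤ) + 1) := fun m n h => by
    simpa using h
  have hPsupp : Function.support P ⊆ range fun n : ℕ => ((n : ℤ) + 1) := by
    intro j hj
    have hjpos : 0 < j := by
      by_contra hneg
      refine hj ?_
      simp only [hP]
      rw [hφ0, ofReal_zero, mul_zero]
      refine div_nonpos_of_nonpos_of_nonneg (mul_nonpos_of_nonneg_of_nonpos (by positivity) ?_) hT0.le
      exact_mod_cast not_lt.mp hneg
    exact ⟨(j - 1).toNat, by simp; omega⟩
  have hPfin : (Function.support P).Finite := by
    refine Set.Finite.subset (Set.finite_Icc (0 : ℤ) ⌈c₁ * T⌉) fun j hj => ?_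
    obtain ⟨n, rfl⟩ := hPsupp hj
    have hne : φ (2 * Real.pi * q * ((n : ℤ) + 1 : ℤ) / T) ≠ 0 := by
      intro h
      apply hj
      simp only [hP]
      rw [h, ofReal_zero, mul_zero]
    have h4 := (hsupp _ hne).2
    refine ⟨by positivity, ?_⟩
    rw [div_le_iff₀ hT0] at h4
    have h5 : (((n : ℤ) + 1 : ℤ) : ℝ) ≤ c₁ * T := by
      refine le_trans ?_ h4
      have h6 : (1 : ℝ) ≤ 2 * Real.pi * q := by nlinarith [Real.pi_gt_three]
      refine le_mul_of_one_le_left ?_ h6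
      push_cast; positivity
    exact_mod_cast h5.trans (Int.le_ceil _)
  have hsP : Summable P := summable_of_hasFiniteSupport hPfin
  have hPt : ∑' j : ℤ, P j = 2 * Real.pi * ∑' j : ℕ, (φ (2 * Real.pi * q * (j + 1) / T) : ℂ) := by
    rw [← hinj.tsum_eq hPsupp, ← tsum_mul_left]
    refine tsum_congr fun n => ?_
    simp only [hP]
    push_cast
    rfl
  rw [← hPt, ← hsD.tsum_sub hsP]
  -- The frequency `j = 0` has its own bound. The power majorant adds nothing there, because `0 ^
  -- (-(3 / 2))` is `0` by convention.
  have hHS : HasSum (fun j : ℤ => (if j = 0 then C₁ * T / T ^ K else 0) +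
      C₂ * (T ^ (1 / 2 + δ) * (q : ℝ) ^ (-(3 / 2) : ℝ)) * |(j : ℝ)| ^ (-(3 / 2) : ℝ))
      (C₁ * T / T ^ K + C₂ * (T ^ (1 / 2 + δ) * (q : ℝ) ^ (-(3 / 2) : ℝ)) * Z) :=
    (hasSum_ite_eq 0 _).add (hZ.hasSum.mul_left _)
  refine (tsum_of_norm_bounded hHS fun j => ?_).trans ?_
  · by_cases hj : j = 0
    · subst hj
      simp only [hP, Int.cast_zero, zero_mul, mul_zero, zero_div, hφ0 0 le_rfl, ofReal_zero,
        sub_zero, if_true, abs_zero]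
      rw [Real.zero_rpow (by norm_num), mul_zero, add_zero]
      exact h₁ b hb T hT hTT
    · rw [if_neg hj, zero_add]
      have h3 := h₂ b hb T hT (j * q) (mul_ne_zero hj (by exact_mod_cast (by omega : q ≠ 0)))
      push_cast at h3
      simp only [hP]
      rw [show 2 * Real.pi * q * j / T = 2 * Real.pi * (j * q) / T by ring]
      refine h3.trans (le_of_eq ?_)
      rw [abs_mul, Real.mul_rpow (abs_nonneg _) (abs_nonneg _), abs_of_nonneg (by positivity : (0:ℝ) ≤ q)]
      ring
  · have p1 : 0 ≤ T ^ (1 / 2 + δ) * (q : ℝ) ^ (-(3 / 2) : ℝ) := by positivity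
    have p2 : 0 ≤ T / T ^ K := by positivity
    have p3 := mul_nonneg hC₁ p1
    have p4 := mul_nonneg (mul_nonneg hC₂ hZ0) p2
    rw [mul_div_assoc]
    nlinarith

/-! ### Smoothed polynomials and off-diagonal decay. -/

/-- The smoothed truncation of the Dirichlet series of `ζ` with weight `W` and length `X`. -/
noncomputable def smoothPoly (W : ℝ → ℝ) (X : ℝ) (s : ℂ) : ℂ :=
  ∑ k ∈ Finset.Icc 1 ⌊3 * X⌋₊, (W (k / X) : ℂ) * (k : ℂ) ^ (-s)

lemma norm_natCast_cpow_neg_le_one {k : ℕ} (hk : 1 ≤ k) {s : ℂ} (hs : 0 ≤ s.re) :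
    ‖(k : ℂ) ^ (-s)‖ ≤ 1 := by
  rw [norm_natCast_cpow_of_pos hk, neg_re]
  exact Real.rpow_le_one_of_one_le_of_nonpos (by exact_mod_cast hk) (by linarith)

lemma norm_smoothPoly_le {W : ℝ → ℝ} (hW : ∀ y, 0 ≤ W y ∧ W y ≤ 1) {X : ℝ} (hX : 0 ≤ X) {s : ℂ}
    (hs : 0 ≤ s.re) : ‖smoothPoly W X s‖ ≤ 3 * X := by
  have h : ∀ k ∈ Finset.Icc 1 ⌊3 * X⌋₊, ‖(W (k / X) : ℂ) * (k : ℂ) ^ (-s)‖ ≤ 1 := by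
    intro k hk
    rw [norm_mul, norm_real, Real.norm_of_nonneg (hW _).1]
    exact mul_le_one₀ (hW _).2 (norm_nonneg _)
      (norm_natCast_cpow_neg_le_one (Finset.mem_Icc.mp hk).1 hs)
  refine (norm_sum_le_of_le _ h).trans ?_
  rw [Finset.sum_const, Nat.card_Icc, nsmul_eq_mul, mul_one, Nat.add_sub_cancel]
  exact Nat.floor_le (by positivity)

lemma continuous_smoothPoly (W : ℝ → ℝ) (X : ℝ) : Continuous (smoothPoly W X) := by
  unfold smoothPoly
  refine continuous_finsetSum _ fun k hk => continuous_const.mul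
    (continuous_neg.const_cpow (Or.inl ?_))
  have := (Finset.mem_Icc.mp hk).1
  exact Nat.cast_ne_zero.mpr (by omega)

lemma exists_norm_zeta_sub_smoothPoly_le {W : ℝ → ℝ}
    (hW : ∀ K : ℕ, ∃ C, 0 ≤ C ∧ ∀ s : ℂ, 1 / 4 ≤ s.re → s.re ≤ 3 / 4 → ∀ X : ℝ, 1 ≤ X →
      ‖riemannZeta s - ∑ k ∈ Finset.Icc 1 ⌊3 * X⌋₊, (W (k / X) : ℂ) * (k : ℂ) ^ (-s)‖ ≤
        C * ((1 + ‖s‖) * X ^ (-(1 / 8) : ℝ) + X / ‖s - 1‖ ^ K))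
    {c₀ c₁ : ℝ} (h₀ : 0 < c₀) (h₁ : 0 < c₁) (r : ℕ) :
    ∃ C, 0 ≤ C ∧ ∀ T : ℝ, 1 ≤ T → ∀ s : ℂ, 1 / 4 ≤ s.re → s.re ≤ 3 / 4 →
      c₀ * T ≤ |s.im| → |s.im| ≤ c₁ * T →
      ‖riemannZeta s - smoothPoly W (T ^ (8 * r)) s‖ ≤ C * (T / T ^ r) := by
  -- With `X = T^{8r}` the truncation error saves `X^{-1/8} = T^{-r}`, and the exponent `9r` makes
  -- the pole term `O(T^{8r-9r})`.
  obtain ⟨C, hC, h⟩ := hW (9 * r)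
  refine ⟨C * ((2 + c₁) + (c₀⁻¹) ^ (9 * r)), by positivity, fun T hT s hs1 hs2 hi0 hi1 => ?_⟩
  have hT0 : 0 < T := by linarith
  refine (h s hs1 hs2 (T ^ (8 * r)) (one_le_pow₀ hT)).trans ?_
  rw [mul_assoc C]
  refine mul_le_mul_of_nonneg_left ?_ hC
  rw [add_mul (2 + c₁)]
  have hre : |s.re| ≤ 1 := by rw [abs_le]; constructor <;> linarith
  have hnorm : 1 + ‖s‖ ≤ (2 + c₁) * T := by
    have := Complex.norm_le_abs_re_add_abs_im s
    nlinarith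
  have hX : (T ^ (8 * r)) ^ (-(1 / 8) : ℝ) = 1 / T ^ r := by
    rw [← Real.rpow_natCast T (8 * r), ← Real.rpow_mul hT0.le, one_div (T ^ r),
      ← Real.rpow_natCast T r, ← Real.rpow_neg hT0.le]
    congr 1; push_cast; ring
  refine add_le_add ?_ ?_
  · rw [hX]
    calc (1 + ‖s‖) * (1 / T ^ r) ≤ (2 + c₁) * T * (1 / T ^ r) := by gcongr
      _ = (2 + c₁) * (T / T ^ r) := by ring
  · have hlow : c₀ * T ≤ ‖s - 1‖ := hi0.trans (by simpa using abs_im_le_norm (s - 1))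
    calc T ^ (8 * r) / ‖s - 1‖ ^ (9 * r) ≤ T ^ (8 * r) / (c₀ * T) ^ (9 * r) := by gcongr
      _ = (c₀⁻¹) ^ (9 * r) * (1 / T ^ r) := by
          rw [mul_pow, inv_pow, show 9 * r = 8 * r + r by ring, pow_add T]
          field_simp
      _ ≤ (c₀⁻¹) ^ (9 * r) * (T / T ^ r) := by gcongr

/-- Truncating at `X = 1` leaves only `1` and `1/(s-1)` as main terms. The resulting crude linear
bound suffices, since it multiplies an arbitrarily small error. -/
lemma exists_norm_zeta_le {c₀ c₁ : ℝ} (h₀ : 0 < c₀) (h₁ : 0 < c₁) :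
    ∃ C, 0 ≤ C ∧ ∀ T : ℝ, 1 ≤ T → ∀ s : ℂ, 1 / 4 ≤ s.re → s.re ≤ 3 / 4 →
      c₀ * T ≤ |s.im| → |s.im| ≤ c₁ * T → ‖riemannZeta s‖ ≤ C * T := by
  obtain ⟨C, hC, h⟩ := exists_norm_zeta_sub_sum_le
  refine ⟨C * (2 + c₁) + 1 + 1 / c₀, by positivity, fun T hT s hs1 hs2 hi0 hi1 => ?_⟩
  have hT0 : 0 < T := by linarith
  have hs : s ≠ 1 := by rintro rfl; norm_num at hs2
  have h2 := h s hs1 hs 1 le_rfl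
  simp only [Nat.floor_one, Finset.Icc_self, Finset.sum_singleton, Nat.cast_one, one_cpow,
    ofReal_one, Real.one_rpow, mul_one] at h2
  have hre : |s.re| ≤ 1 := by rw [abs_le]; constructor <;> linarith
  have hnorm : 1 + ‖s‖ ≤ (2 + c₁) * T := by
    have := Complex.norm_le_abs_re_add_abs_im s
    nlinarith
  have hlow : c₀ * T ≤ ‖s - 1‖ := hi0.trans (by simpa using abs_im_le_norm (s - 1))
  have h3 : ‖1 / (s - 1)‖ ≤ 1 / c₀ := by
    rw [norm_div, norm_one]
    refine one_div_le_one_div_of_le h₀ (le_trans ?_ hlow)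
    nlinarith
  calc ‖riemannZeta s‖ = ‖(riemannZeta s - 1 - 1 / (s - 1)) + 1 + 1 / (s - 1)‖ := by
        congr 1; ring
    _ ≤ ‖riemannZeta s - 1 - 1 / (s - 1)‖ + ‖(1 : ℂ)‖ + ‖1 / (s - 1)‖ := norm_add₃_le
    _ ≤ C * ((2 + c₁) * T) + 1 + 1 / c₀ := by
        rw [norm_one]
        gcongr
        exact h2.trans (by gcongr)
    _ ≤ (C * (2 + c₁) + 1 + 1 / c₀) * T := by
        have : 0 < 1 / c₀ := by positivity
        nlinarith

lemma continuous_twist (b : ℂ) {q l : ℕ} (hq : 1 ≤ q) (hl : 1 ≤ l) :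
    Continuous fun t : ℝ => (q : ℂ) ^ (-(1 / 2 + t * I)) * (l : ℂ) ^ (-(1 / 2 - t * I + b)) := by
  have h : ∀ {n : ℕ}, 1 ≤ n → ∀ g : ℝ → ℂ, Continuous g → Continuous fun t => (n : ℂ) ^ g t :=
    fun hn g hg => hg.const_cpow (Or.inl (Nat.cast_ne_zero.mpr (by omega)))
  exact (h hq _ (by fun_prop)).mul (h hl _ (by fun_prop))

lemma integrable_twist {φ : ℝ → ℝ} (hφ : Continuous φ) (hc : HasCompactSupport φ) {T : ℝ}
    (hT : 0 < T) (b : ℂ) {q l : ℕ} (hq : 1 ≤ q) (hl : 1 ≤ l) :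
    Integrable fun t : ℝ => (φ (t / T) : ℂ) *
      ((q : ℂ) ^ (-(1 / 2 + t * I)) * (l : ℂ) ^ (-(1 / 2 - t * I + b))) :=
  Continuous.integrable_of_hasCompactSupport
    ((by fun_prop : Continuous fun t : ℝ => (φ (t / T) : ℂ)).mul (continuous_twist b hq hl))
    (hasCompactSupport_comp_div hc hT).mul_right

lemma integral_twist_sum {φ : ℝ → ℝ} (hφ : Continuous φ) (hc : HasCompactSupport φ) {T : ℝ}
    (hT : 0 < T) (b : ℂ) {q : ℕ} (hq : 1 ≤ q) (L : ℕ) (w : ℕ → ℂ) :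
    ∫ t : ℝ, (φ (t / T) : ℂ) * ((q : ℂ) ^ (-(1 / 2 + t * I)) *
      ∑ l ∈ Finset.Icc 1 L, w l * (l : ℂ) ^ (-(1 / 2 - t * I + b))) =
    ∑ l ∈ Finset.Icc 1 L, w l * ∫ t : ℝ, (φ (t / T) : ℂ) *
      ((q : ℂ) ^ (-(1 / 2 + t * I)) * (l : ℂ) ^ (-(1 / 2 - t * I + b))) := by
  simp_rw [← integral_const_mul]
  rw [← integral_finsetSum _ fun l hl =>
    (integrable_twist hφ hc hT b hq (Finset.mem_Icc.mp hl).1).const_mul _]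
  congr 1; ext t
  rw [Finset.mul_sum, Finset.mul_sum]
  refine Finset.sum_congr rfl fun l _ => ?_
  ring

lemma integral_twist_eq {φ : ℝ → ℝ} (hφ : ContDiff ℝ ∞ φ) (hc : HasCompactSupport φ) {T : ℝ}
    (hT : 0 < T) (b : ℂ) {q l : ℕ} (hq : 1 ≤ q) (hl : 1 ≤ l) :
    ∫ t : ℝ, (φ (t / T) : ℂ) *
      ((q : ℂ) ^ (-(1 / 2 + t * I)) * (l : ℂ) ^ (-(1 / 2 - t * I + b))) =
    (q : ℂ) ^ (-(1 / 2) : ℂ) * (l : ℂ) ^ (-(1 / 2 + b)) *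
      (T * invFourier φ hφ hc (T * Real.log (l / q) / (2 * Real.pi))) := by
  have hqC : (q : ℂ) ≠ 0 := Nat.cast_ne_zero.mpr (by omega)
  have hlC : (l : ℂ) ≠ 0 := Nat.cast_ne_zero.mpr (by omega)
  have hq0 : (0 : ℝ) < q := by exact_mod_cast hq
  have hl0 : (0 : ℝ) < l := by exact_mod_cast hl
  rw [← integral_comp_div_mul_cexp hφ hc hT, ← integral_const_mul]
  congr 1; ext t
  have e1 : (q : ℂ) ^ (-(1 / 2 + (t : ℂ) * I)) =
      (q : ℂ) ^ (-(1 / 2) : ℂ) * cexp (-(Real.log q : ℂ) * (t * I)) := by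
    rw [neg_add, cpow_add _ _ hqC, cpow_def_of_ne_zero hqC (-(t * I)), ← natCast_log]
    congr 2; ring
  have e2 : (l : ℂ) ^ (-(1 / 2 - (t : ℂ) * I + b)) =
      (l : ℂ) ^ (-(1 / 2 + b)) * cexp ((Real.log l : ℂ) * (t * I)) := by
    rw [show -(1 / 2 - (t : ℂ) * I + b) = -(1 / 2 + b) + t * I by ring, cpow_add _ _ hlC,
      cpow_def_of_ne_zero hlC (t * I), ← natCast_log]
  have e3 : cexp (t * (Real.log (l / q) : ℝ) * I) =
      cexp (-(Real.log q : ℂ) * (t * I)) * cexp ((Real.log l : ℂ) * (t * I)) := by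
    rw [Real.log_div hl0.ne' hq0.ne', ← Complex.exp_add]
    congr 1; push_cast; ring
  rw [e1, e2, e3]
  ring

/-- The `t`-integral is a Schwartz function evaluated at `T log(l/q) / 2π`, of absolute value at
least `T / 4π` here. -/
lemma exists_norm_integral_twist_le {φ : ℝ → ℝ} (hφ : ContDiff ℝ ∞ φ) (hc : HasCompactSupport φ)
    (K : ℕ) : ∃ C, 0 ≤ C ∧ ∀ b : ℂ, ‖b‖ ≤ 1 / 4 → ∀ T : ℝ, 1 ≤ T → ∀ q l : ℕ, 1 ≤ q → 1 ≤ l →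
      1 / 2 ≤ |Real.log (l / q)| →
      ‖∫ t : ℝ, (φ (t / T) : ℂ) *
        ((q : ℂ) ^ (-(1 / 2 + t * I)) * (l : ℂ) ^ (-(1 / 2 - t * I + b)))‖ ≤ C * (T / T ^ K) := by
  obtain ⟨C, hC⟩ := (invFourier φ hφ hc).decay K 0
  simp only [norm_iteratedFDeriv_zero] at hC
  refine ⟨|C| * (4 * Real.pi) ^ K, by positivity, fun b hb T hT q l hq hl hlog => ?_⟩
  have hT0 : 0 < T := by linarith
  have hbre := (abs_re_le_norm b).trans hb
  rw [abs_le] at hbre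
  set w := T * Real.log (l / q) / (2 * Real.pi) with hw
  have hwl : T / (4 * Real.pi) ≤ ‖w‖ := by
    rw [hw, Real.norm_eq_abs, abs_div, abs_mul, abs_of_pos hT0, abs_of_pos Real.two_pi_pos,
      div_le_div_iff₀ (by positivity) (by positivity)]
    nlinarith [mul_pos hT0 Real.pi_pos]
  have hΨ : ‖invFourier φ hφ hc w‖ ≤ |C| * (4 * Real.pi) ^ K / T ^ K := by
    have h1 : (T / (4 * Real.pi)) ^ K * ‖invFourier φ hφ hc w‖ ≤ |C| := by
      refine le_trans ?_ ((hC.2 w).trans (le_abs_self C))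
      gcongr
    rw [mul_comm, ← le_div_iff₀ (by positivity)] at h1
    refine h1.trans (le_of_eq ?_)
    rw [div_pow]
    field_simp
  rw [integral_twist_eq hφ hc hT0 b hq hl, norm_mul, norm_mul, norm_mul, norm_real,
    Real.norm_of_nonneg hT0.le]
  have h1 : ‖(q : ℂ) ^ (-(1 / 2) : ℂ)‖ ≤ 1 := norm_natCast_cpow_neg_le_one hq (by norm_num)
  have h2 : ‖(l : ℂ) ^ (-(1 / 2 + b))‖ ≤ 1 :=
    norm_natCast_cpow_neg_le_one hl (by rw [add_re]; norm_num; linarith)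
  calc ‖(q : ℂ) ^ (-(1 / 2) : ℂ)‖ * ‖(l : ℂ) ^ (-(1 / 2 + b))‖ * (T * ‖invFourier φ hφ hc w‖)
      ≤ 1 * 1 * (T * (|C| * (4 * Real.pi) ^ K / T ^ K)) := by gcongr
    _ = |C| * (4 * Real.pi) ^ K * (T / T ^ K) := by ring

/-- The twisted first moment of the smoothed Dirichlet polynomial, at a single frequency. -/
lemma exists_norm_integral_smoothPoly_sub_le {φ : ℝ → ℝ} (hφ : ContDiff ℝ ∞ φ)
    (hc : HasCompactSupport φ) (hp : tsupport φ ⊆ Ioi 0) {W : ℝ → ℝ}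
    (hW : ∀ y, 0 ≤ W y ∧ W y ≤ 1) (hW1 : ∀ y ≤ 1, W y = 1) {δ : ℝ} (hδ : 0 < δ) (K : ℕ) :
    ∃ C T₁, 0 ≤ C ∧ ∀ b : ℂ, ‖b‖ ≤ 1 / 4 → ∀ T : ℝ, 1 ≤ T → T₁ ≤ T → ∀ q : ℕ, 1 ≤ q →
      ∀ Y : ℝ, 3 * q ≤ Y →
      ‖(∫ t : ℝ, (φ (t / T) : ℂ) *
          ((q : ℂ) ^ (-(1 / 2 + t * I)) * smoothPoly W Y (1 / 2 - t * I + b))) -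
        (q : ℂ) ^ (-b) * (2 * Real.pi * ∑' j : ℕ, (φ (2 * Real.pi * q * (j + 1) / T) : ℂ))‖ ≤
        C * (‖(q : ℂ) ^ (-b)‖ * (T ^ (1 / 2 + δ) * (q : ℝ) ^ (-(3 / 2) : ℝ) + T / T ^ K) +
          Y * (T / T ^ K)) := by
  obtain ⟨C₁, T₁, hC₁, h₁⟩ := exists_norm_tsum_dualTerm_sub_le hφ hc hp hδ K
  obtain ⟨C₂, hC₂, h₂⟩ := exists_norm_integral_twist_le hφ hc K
  refine ⟨C₁ + 6 * C₂, T₁, by positivity, fun b hb T hT hTT q hq Y hY => ?_⟩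
  have hT0 : 0 < T := by linarith
  have hqr : (1 : ℝ) ≤ q := by exact_mod_cast hq
  have hq0 : (0 : ℝ) < q := by linarith
  have hY0 : 0 < Y := by linarith
  set L := ⌊3 * Y⌋₊ with hL
  have hL3 : (L : ℝ) ≤ 3 * Y := Nat.floor_le (by positivity)
  have hqL : 3 * (q : ℝ) ≤ L := by
    have : 3 * q ≤ L := Nat.le_floor (by push_cast; linarith)
    exact_mod_cast this
  have hP := (integral_sum_cutoff_eq hφ.continuous hc hp hb hT0 hqr hqL).2
  rw [ofReal_natCast] at hP
  -- The weight `W (l / Y)` is exchanged for the cutoff around `q`. If `|log(l/q)| ≤ 1/2` then `l ≤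
  -- 3q ≤ Y` and both equal `1`; all other `l` are negligible.
  have hdiff : ‖(∫ t : ℝ, (φ (t / T) : ℂ) *
      ((q : ℂ) ^ (-(1 / 2 + t * I)) * smoothPoly W Y (1 / 2 - t * I + b))) -
      (q : ℂ) ^ (-b) * ∑' j : ℤ, dualTerm φ b T (j * q)‖ ≤ 6 * C₂ * (Y * (T / T ^ K)) := by
    rw [← hP]
    simp only [smoothPoly]
    rw [integral_twist_sum hφ.continuous hc hT0 b hq, integral_twist_sum hφ.continuous hc hT0 b hq,
      ← Finset.sum_sub_distrib]
    have hterm : ∀ l ∈ Finset.Icc 1 L, ‖(W (l / Y) : ℂ) * (∫ t : ℝ, (φ (t / T) : ℂ) *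
        ((q : ℂ) ^ (-(1 / 2 + t * I)) * (l : ℂ) ^ (-(1 / 2 - t * I + b)))) -
        cutoff (Real.log (l / q)) * ∫ t : ℝ, (φ (t / T) : ℂ) *
        ((q : ℂ) ^ (-(1 / 2 + t * I)) * (l : ℂ) ^ (-(1 / 2 - t * I + b)))‖ ≤
        2 * (C₂ * (T / T ^ K)) := by
      intro l hl
      have hl1 := (Finset.mem_Icc.mp hl).1
      have hl0 : (0 : ℝ) < l := by exact_mod_cast hl1
      rw [← sub_mul, norm_mul]
      rcases le_or_gt |Real.log (l / q)| (1 / 2) with hs | hs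
      · have hlY : (l : ℝ) / Y ≤ 1 := by
          rw [div_le_one hY0]
          have h3 : Real.log (l / q) ≤ 1 := by linarith [le_abs_self (Real.log (l / q))]
          rw [Real.log_le_iff_le_exp (by positivity), div_le_iff₀ hq0] at h3
          nlinarith [Real.exp_one_lt_d9]
        rw [cutoff_eq_one hs, hW1 _ hlY, ofReal_one, sub_self, norm_zero, zero_mul]
        positivity
      · refine mul_le_mul ?_ (h₂ b hb T hT q l hq hl1 hs.le) (norm_nonneg _) zero_le_two
        refine (norm_sub_le _ _).trans ?_
        rw [norm_real, Real.norm_of_nonneg (hW _).1]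
        linarith [(hW (l / Y)).2, norm_cutoff_le (Real.log (l / q))]
    refine (norm_sum_le_of_le _ hterm).trans ?_
    rw [Finset.sum_const, Nat.card_Icc, nsmul_eq_mul, Nat.add_sub_cancel]
    calc (L : ℝ) * (2 * (C₂ * (T / T ^ K))) ≤ 3 * Y * (2 * (C₂ * (T / T ^ K))) := by gcongr
      _ = 6 * C₂ * (Y * (T / T ^ K)) := by ring
  have hmain : ‖(q : ℂ) ^ (-b) * ∑' j : ℤ, dualTerm φ b T (j * q) -
      (q : ℂ) ^ (-b) * (2 * Real.pi * ∑' j : ℕ, (φ (2 * Real.pi * q * (j + 1) / T) : ℂ))‖ ≤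
      C₁ * (‖(q : ℂ) ^ (-b)‖ * (T ^ (1 / 2 + δ) * (q : ℝ) ^ (-(3 / 2) : ℝ) + T / T ^ K)) := by
    rw [← mul_sub, norm_mul]
    calc _ ≤ ‖(q : ℂ) ^ (-b)‖ *
          (C₁ * (T ^ (1 / 2 + δ) * (q : ℝ) ^ (-(3 / 2) : ℝ) + T / T ^ K)) := by
          gcongr
          exact h₁ b hb T hT hTT q hq
      _ = _ := by ring
  refine (norm_sub_le_norm_sub_add_norm_sub _ _ _).trans ((add_le_add hdiff hmain).trans ?_)
  have p1 : 0 ≤ ‖(q : ℂ) ^ (-b)‖ * (T ^ (1 / 2 + δ) * (q : ℝ) ^ (-(3 / 2) : ℝ) + T / T ^ K) := by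
    positivity
  have p2 : 0 ≤ Y * (T / T ^ K) := by positivity
  nlinarith [mul_nonneg hC₁ p2, mul_nonneg hC₂ p1]

/-! ### Matching the kernel with the dual sums. -/

/-- The main term at frequency `n`, unfolded into a sum over the truncated range. -/
lemma kernelF_mul_eq_sum {φ : ℝ → ℝ} (hφ : ContDiff ℝ ∞ φ) (hc : HasCompactSupport φ)
    (hp : tsupport φ ⊆ Ioi 0) {W : ℝ → ℝ} (hW1 : ∀ y ≤ 1, W y = 1) {c₁ : ℝ}
    (hsupp : ∀ x, φ x ≠ 0 → x ≤ c₁) {T X : ℝ} (hT : 0 < T) (hX : 0 < X) (hTX : c₁ * T ≤ X)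
    {α β : ℂ} (hα : ‖α‖ ≤ 1 / 4) (hβ : ‖β‖ ≤ 1 / 4) {n : ℕ} (hn : 1 ≤ n) :
    (T : ℂ) * (1 / (n : ℂ) ^ (1 + β) * kernelF φ ((α + β) / 2) (T / (2 * Real.pi * n))) =
      ∑ k ∈ Finset.Icc 1 ⌊3 * X⌋₊, (W (k / X) : ℂ) * (k : ℂ) ^ (-α) * (((n * k : ℕ) : ℂ) ^ (-β) *
        (2 * Real.pi * ∑' j : ℕ, (φ (2 * Real.pi * (n * k : ℕ) * (j + 1) / T) : ℂ))) := by
  have hn0 : (0 : ℝ) < n := by exact_mod_cast hn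
  have hnC : (n : ℂ) ≠ 0 := Nat.cast_ne_zero.mpr (by omega)
  have hTC : (T : ℂ) ≠ 0 := by exact_mod_cast hT.ne'
  have hpi : (Real.pi : ℂ) ≠ 0 := by exact_mod_cast Real.pi_ne_zero
  have hγ : |((α + β) / 2).re| < 1 := by
    have := abs_re_le_norm ((α + β) / 2)
    have h2 : ‖(α + β) / 2‖ ≤ 1 / 4 := by
      rw [norm_div, RCLike.norm_ofNat]
      linarith [norm_add_le α β]
    linarith
  rw [kernelF_eq_tsum hφ hc hp hγ (by positivity : 0 < T / (2 * Real.pi * n))]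
  set G : ℕ × ℕ → ℂ := fun p => ((p.1 + 1 : ℕ) : ℂ) ^ (-(2 * ((α + β) / 2))) *
      (φ (((p.1 + 1 : ℕ) : ℝ) * ((p.2 + 1 : ℕ) : ℝ) / (T / (2 * Real.pi * n))) : ℂ) with hG
  have hbound : ∀ p : ℕ × ℕ, G p ≠ 0 →
      ((p.1 + 1 : ℕ) : ℝ) * ((p.2 + 1 : ℕ) : ℝ) ≤ c₁ * T := by
    intro p hp0
    have h1 : φ (((p.1 + 1 : ℕ) : ℝ) * ((p.2 + 1 : ℕ) : ℝ) / (T / (2 * Real.pi * n))) ≠ 0 := by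
      intro h
      apply hp0
      simp only [hG]
      rw [h, ofReal_zero, mul_zero]
    have h2 := hsupp _ h1
    rw [div_div_eq_mul_div, div_le_iff₀ hT] at h2
    refine le_trans (le_mul_of_one_le_right (by positivity) ?_) h2
    have : (1 : ℝ) ≤ n := by exact_mod_cast hn
    nlinarith [Real.pi_gt_three]
  have hfin : (Function.support G).Finite := by
    refine Set.Finite.subset
      ((Finset.range ⌊c₁ * T⌋₊ ×ˢ Finset.range ⌊c₁ * T⌋₊).finite_toSet) fun p hp0 => ?_
    have h := hbound p hp0
    have ha : (1 : ℝ) ≤ ((p.1 + 1 : ℕ) : ℝ) := by exact_mod_cast Nat.succ_le_succ (Nat.zero_le _)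
    have hb : (1 : ℝ) ≤ ((p.2 + 1 : ℕ) : ℝ) := by exact_mod_cast Nat.succ_le_succ (Nat.zero_le _)
    simp only [Finset.coe_product, mem_prod, Finset.coe_range, mem_Iio]
    constructor
    · exact Nat.lt_of_succ_le (Nat.le_floor (by nlinarith))
    · exact Nat.lt_of_succ_le (Nat.le_floor (by nlinarith))
  have hGs : Summable G := summable_of_hasFiniteSupport hfin
  rw [hGs.tsum_prod]
  set H : ℕ → ℂ := fun k => (W (k / X) : ℂ) * (k : ℂ) ^ (-α) * (((n * k : ℕ) : ℂ) ^ (-β) *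
        (2 * Real.pi * ∑' j : ℕ, (φ (2 * Real.pi * (n * k : ℕ) * (j + 1) / T) : ℂ))) with hH
  have hIcc : ∑ k ∈ Finset.Icc 1 ⌊3 * X⌋₊, H k = ∑ k ∈ Finset.range ⌊3 * X⌋₊, H (k + 1) := by
    rw [Finset.range_eq_Ico, Finset.sum_Ico_add' H 0 _ 1]
    rfl
  rw [hIcc, tsum_eq_sum (s := Finset.range ⌊3 * X⌋₊), Finset.mul_sum, Finset.mul_sum,
    Finset.mul_sum]
  · refine Finset.sum_congr rfl fun k _ => ?_
    have hkC : ((k + 1 : ℕ) : ℂ) ≠ 0 := Nat.cast_ne_zero.mpr k.succ_ne_zero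
    simp only [hG, hH]
    rw [tsum_mul_left]
    have harg : ∀ j : ℕ, φ (((k + 1 : ℕ) : ℝ) * ((j + 1 : ℕ) : ℝ) / (T / (2 * Real.pi * n))) =
        φ (2 * Real.pi * (n * (k + 1) : ℕ) * (j + 1) / T) := by
      intro j
      congr 1
      push_cast
      field_simp
    simp_rw [harg]
    -- Either both sides vanish, or some nonzero value of `φ` forces `k + 1 ≤ c₁ T ≤ X`, so that the
    -- weight `W` equals `1`.
    by_cases hz : ∀ j : ℕ, φ (2 * Real.pi * (n * (k + 1) : ℕ) * (j + 1) / T) = 0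
    · simp only [hz, ofReal_zero, tsum_zero, mul_zero]
    · push Not at hz
      obtain ⟨j, hj⟩ := hz
      have hkX : ((k + 1 : ℕ) : ℝ) / X ≤ 1 := by
        rw [div_le_one hX]
        rw [← harg] at hj
        have h := hbound (k, j) (by
          simp only [hG]
          refine mul_ne_zero ?_ (ofReal_ne_zero.mpr hj)
          rw [Ne, cpow_eq_zero_iff]
          exact fun h => hkC h.1)
        refine le_trans ?_ (h.trans hTX)
        refine le_mul_of_one_le_right (by positivity) ?_
        exact_mod_cast Nat.succ_le_succ (Nat.zero_le _)
      have hmul : ((n * (k + 1) : ℕ) : ℂ) ^ (-β) = (n : ℂ) ^ (-β) * ((k + 1 : ℕ) : ℂ) ^ (-β) := by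
        rw [Nat.cast_mul, natCast_mul_natCast_cpow]
      rw [hW1 _ hkX, ofReal_one, one_mul, hmul,
        show -(2 * ((α + β) / 2)) = -α + -β by ring, cpow_add _ _ hkC, cpow_add _ _ hnC, cpow_one,
        cpow_neg (n : ℂ)]
      have hnβ : (n : ℂ) ^ β ≠ 0 := by
        rw [Ne, cpow_eq_zero_iff]; exact fun h => hnC h.1
      push_cast
      field_simp
  · intro k hk
    rw [Finset.mem_range, not_lt] at hk
    have hz : ∀ j, G (k, j) = 0 := by
      intro j
      by_contra h0
      have h := hbound (k, j) h0
      have hb : (1 : ℝ) ≤ ((j + 1 : ℕ) : ℝ) := by exact_mod_cast Nat.succ_le_succ (Nat.zero_le _)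
      have h3 : ((k + 1 : ℕ) : ℝ) ≤ 3 * X := by
        refine le_trans (le_mul_of_one_le_right (by positivity) hb) (h.trans (hTX.trans ?_))
        linarith
      have := Nat.le_floor h3
      omega
    simp [hz]

/-! ### Replacing zeta by polynomials inside the moment. -/

/-- This is where shifts of size `1 / log T` matter: they change powers of integers polynomially
bounded in `T` only by a constant factor. -/
lemma norm_natCast_cpow_neg_le_exp {T κ : ℝ} (hT : 1 ≤ Real.log T) (hT0 : 0 < T) {a : ℂ}
    (ha : ‖a‖ ≤ κ / Real.log T) {n Q : ℕ} (hn : 1 ≤ n) (hnQ : (n : ℝ) ≤ 3 * T ^ Q) :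
    ‖(n : ℂ) ^ (-a)‖ ≤ Real.exp (|κ| * (2 + Q)) := by
  have hn1 : (1 : ℝ) ≤ n := by exact_mod_cast hn
  have hn0 : (0 : ℝ) < n := by linarith
  have hlog0 : 0 < Real.log T := by linarith
  rw [norm_natCast_cpow_of_pos hn, Real.rpow_def_of_pos hn0, Real.exp_le_exp]
  have h1 : Real.log n ≤ (2 + Q) * Real.log T := by
    have h3 : Real.log 3 ≤ 2 := by
      have := Real.log_le_sub_one_of_pos (by norm_num : (0 : ℝ) < 3)
      linarith
    calc Real.log n ≤ Real.log (3 * T ^ Q) := Real.log_le_log hn0 hnQ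
      _ = Real.log 3 + Q * Real.log T := by
          rw [Real.log_mul (by norm_num) (by positivity), Real.log_pow]
      _ ≤ (2 + Q) * Real.log T := by nlinarith
  have h2 : (-a).re ≤ |κ| / Real.log T := by
    calc (-a).re ≤ ‖-a‖ := re_le_norm _
      _ = ‖a‖ := norm_neg a
      _ ≤ κ / Real.log T := ha
      _ ≤ |κ| / Real.log T := by gcongr; exact le_abs_self κ
  calc Real.log n * (-a).re ≤ Real.log n * (|κ| / Real.log T) :=
        mul_le_mul_of_nonneg_left h2 (Real.log_nonneg hn1)
    _ ≤ (2 + Q) * Real.log T * (|κ| / Real.log T) := by gcongr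
    _ = |κ| * (2 + Q) := by field_simp

lemma continuous_dirichletPoly (N : ℕ) (a : ℕ → ℂ) : Continuous (dirichletPoly N a) := by
  unfold dirichletPoly
  refine continuous_finsetSum _ fun k hk => continuous_const.mul
    (continuous_neg.const_cpow (Or.inl ?_))
  have := (Finset.mem_Icc.mp hk).1
  exact Nat.cast_ne_zero.mpr (by omega)

lemma norm_dirichletPoly_le {N : ℕ} {a : ℕ → ℂ} {A : ℝ} (ha : ∀ n ∈ Finset.Icc 1 N, ‖a n‖ ≤ A)
    {s : ℂ} (hs : 0 ≤ s.re) : ‖dirichletPoly N a s‖ ≤ N * A := by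
  have h : ∀ n ∈ Finset.Icc 1 N, ‖a n * (n : ℂ) ^ (-s)‖ ≤ A := by
    intro n hn
    rw [norm_mul]
    exact (mul_le_of_le_one_right (norm_nonneg _)
      (norm_natCast_cpow_neg_le_one (Finset.mem_Icc.mp hn).1 hs)).trans (ha n hn)
  refine (norm_sum_le_of_le _ h).trans (le_of_eq ?_)
  rw [Finset.sum_const, Nat.card_Icc, nsmul_eq_mul, Nat.add_sub_cancel]

/-- The sign `σ = ±1` covers the arguments of both zeta factors at once. -/
lemma shift_bounds {c₀ c₁ T t : ℝ} (h₀ : 0 < c₀) (hT : 1 ≤ T) (hT₀ : 1 / c₀ ≤ T)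
    (ht0 : c₀ * T ≤ t) (ht1 : t ≤ c₁ * T) {a : ℂ} (ha : ‖a‖ ≤ 1 / 4) {σ : ℝ} (hσ : |σ| = 1) :
    1 / 4 ≤ (1 / 2 + ((σ * t : ℝ) : ℂ) * I + a).re ∧
    (1 / 2 + ((σ * t : ℝ) : ℂ) * I + a).re ≤ 3 / 4 ∧
    c₀ / 2 * T ≤ |(1 / 2 + ((σ * t : ℝ) : ℂ) * I + a).im| ∧
    |(1 / 2 + ((σ * t : ℝ) : ℂ) * I + a).im| ≤ (c₁ + 1) * T := by
  have hr := (abs_re_le_norm a).trans ha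
  have hi := (abs_im_le_norm a).trans ha
  rw [div_le_iff₀ h₀] at hT₀
  have ht : 0 ≤ t := le_trans (by positivity) ht0
  have hre : (1 / 2 + ((σ * t : ℝ) : ℂ) * I + a).re = 1 / 2 + a.re := by
    simp [mul_re]
  have him : (1 / 2 + ((σ * t : ℝ) : ℂ) * I + a).im = σ * t + a.im := by
    simp [mul_im]
  have habs : |σ * t| = t := by rw [abs_mul, hσ, one_mul, abs_of_nonneg ht]
  rw [hre, him]
  rw [abs_le] at hr
  refine ⟨by linarith, by linarith, ?_, ?_⟩
  · have h1 : |σ * t| ≤ |σ * t + a.im| + |a.im| := by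
      calc |σ * t| = |(σ * t + a.im) - a.im| := by rw [add_sub_cancel_right]
        _ ≤ |σ * t + a.im| + |a.im| := abs_sub _ _
    nlinarith
  · refine (abs_add_le _ _).trans ?_
    rw [habs]
    nlinarith

lemma integrable_twisted_zeta {φ : ℝ → ℝ} (hφ : Continuous φ) (hc : HasCompactSupport φ)
    {c₀ : ℝ} (h₀ : 0 < c₀) (hsupp : ∀ x, φ x ≠ 0 → c₀ ≤ x) {T : ℝ} (hT : 1 ≤ T)
    (hT₀ : 1 / c₀ ≤ T) {f : ℂ → ℂ} (hf : Continuous f) {α β : ℂ} (hα : ‖α‖ ≤ 1 / 4)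
    (hβ : ‖β‖ ≤ 1 / 4) :
    Integrable fun t : ℝ => f (1 / 2 + t * I) * riemannZeta (1 / 2 + t * I + α) *
      riemannZeta (1 / 2 - t * I + β) * (φ (t / T) : ℂ) := by
  have hT0 : 0 < T := by linarith
  refine Continuous.integrable_of_hasCompactSupport ?_
    (hasCompactSupport_comp_div hc hT0).mul_left
  rw [continuous_iff_continuousAt]
  intro t
  rcases lt_or_ge t (c₀ * T) with ht | ht
  · refine (continuousAt_const (y := (0 : ℂ))).congr ?_
    filter_upwards [Iio_mem_nhds ht] with u hu
    have : φ (u / T) = 0 := by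
      by_contra h
      have h2 := hsupp _ h
      rw [le_div_iff₀ hT0] at h2
      exact absurd hu (not_lt.mpr h2)
    rw [this, ofReal_zero, mul_zero]
  · have e : ∀ u : ℝ, (1 / 2 - u * I + β) = 1 / 2 + ((-1 * u : ℝ) : ℂ) * I + β := by
      intro u; push_cast; ring
    have e' : ∀ u : ℝ, (1 / 2 + u * I + α) = 1 / 2 + ((1 * u : ℝ) : ℂ) * I + α := by
      intro u; push_cast; ring
    have hc1 : t ≤ t / T * T := by rw [div_mul_cancel₀ _ hT0.ne']
    have hne1 : 1 / 2 + t * I + α ≠ 1 := by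
      intro h
      have := (shift_bounds h₀ hT hT₀ ht hc1 hα (σ := 1) (by norm_num)).2.1
      rw [← e', h, one_re] at this
      norm_num at this
    have hne2 : 1 / 2 - t * I + β ≠ 1 := by
      intro h
      have := (shift_bounds h₀ hT hT₀ ht hc1 hβ (σ := -1) (by norm_num)).2.1
      rw [← e, h, one_re] at this
      norm_num at this
    have c1 : ContinuousAt (fun u : ℝ => riemannZeta (1 / 2 + u * I + α)) t :=
      ContinuousAt.comp (g := riemannZeta) (differentiableAt_riemannZeta hne1).continuousAt
        (by fun_prop)
    have c2 : ContinuousAt (fun u : ℝ => riemannZeta (1 / 2 - u * I + β)) t :=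
      ContinuousAt.comp (g := riemannZeta) (differentiableAt_riemannZeta hne2).continuousAt
        (by fun_prop)
    have c3 : ContinuousAt (fun u : ℝ => f (1 / 2 + u * I)) t :=
      (by fun_prop : Continuous fun u : ℝ => f (1 / 2 + u * I)).continuousAt
    have c4 : ContinuousAt (fun u : ℝ => (φ (u / T) : ℂ)) t :=
      (by fun_prop : Continuous fun u : ℝ => (φ (u / T) : ℂ)).continuousAt
    exact ((c3.mul c1).mul c2).mul c4

lemma integrable_twisted_smoothPoly {φ : ℝ → ℝ} (hφ : Continuous φ) (hc : HasCompactSupport φ)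
    {T : ℝ} (hT : 0 < T) {f : ℂ → ℂ} (hf : Continuous f) (W : ℝ → ℝ) (X Y : ℝ) (α β : ℂ) :
    Integrable fun t : ℝ => f (1 / 2 + t * I) * smoothPoly W X (1 / 2 + t * I + α) *
      smoothPoly W Y (1 / 2 - t * I + β) * (φ (t / T) : ℂ) := by
  have h1 := continuous_smoothPoly W X
  have h2 := continuous_smoothPoly W Y
  exact Continuous.integrable_of_hasCompactSupport (by fun_prop)
    (hasCompactSupport_comp_div hc hT).mul_left

/-- Replacing both zeta factors by smoothed Dirichlet polynomials. -/
lemma exists_norm_integral_zeta_sub_smoothPoly_le {φ : ℝ → ℝ} (hφ : Continuous φ)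
    (hc : HasCompactSupport φ) {W : ℝ → ℝ} (hW01 : ∀ y, 0 ≤ W y ∧ W y ≤ 1)
    (hW : ∀ K : ℕ, ∃ C, 0 ≤ C ∧ ∀ s : ℂ, 1 / 4 ≤ s.re → s.re ≤ 3 / 4 → ∀ X : ℝ, 1 ≤ X →
      ‖riemannZeta s - ∑ k ∈ Finset.Icc 1 ⌊3 * X⌋₊, (W (k / X) : ℂ) * (k : ℂ) ^ (-s)‖ ≤
        C * ((1 + ‖s‖) * X ^ (-(1 / 8) : ℝ) + X / ‖s - 1‖ ^ K))
    {c₀ c₁ : ℝ} (h₀ : 0 < c₀) (h₁ : 0 < c₁) (hsupp : ∀ x, φ x ≠ 0 → c₀ ≤ x ∧ x ≤ c₁)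
    (r r' : ℕ) :
    ∃ C, 0 ≤ C ∧ ∀ T : ℝ, 1 ≤ T → 1 / c₀ ≤ T → ∀ f : ℂ → ℂ, Continuous f → ∀ D : ℝ, 0 ≤ D →
      (∀ t : ℝ, ‖f (1 / 2 + t * I)‖ ≤ D) → ∀ α β : ℂ, ‖α‖ ≤ 1 / 4 → ‖β‖ ≤ 1 / 4 →
      ‖(∫ t : ℝ, f (1 / 2 + t * I) * riemannZeta (1 / 2 + t * I + α) *
          riemannZeta (1 / 2 - t * I + β) * (φ (t / T) : ℂ)) -
        ∫ t : ℝ, f (1 / 2 + t * I) * smoothPoly W (T ^ (8 * r)) (1 / 2 + t * I + α) *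
          smoothPoly W (T ^ (8 * r')) (1 / 2 - t * I + β) * (φ (t / T) : ℂ)‖ ≤
        C * (D * T * (T / T ^ r * T + T ^ (8 * r) * (T / T ^ r'))) := by
  obtain ⟨C₁, hC₁, hz₁⟩ := exists_norm_zeta_sub_smoothPoly_le hW (half_pos h₀)
    (by linarith : 0 < c₁ + 1) r
  obtain ⟨C₂, hC₂, hz₂⟩ := exists_norm_zeta_sub_smoothPoly_le hW (half_pos h₀)
    (by linarith : 0 < c₁ + 1) r'
  obtain ⟨C₃, hC₃, hz₃⟩ := exists_norm_zeta_le (half_pos h₀) (by linarith : 0 < c₁ + 1)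
  have hI0 : 0 ≤ ∫ u, |φ u| := integral_nonneg fun u => abs_nonneg _
  refine ⟨(C₁ * C₃ + 3 * C₂) * ∫ u, |φ u|, by positivity,
    fun T hT hT₀ f hf D hD hfD α β hα hβ => ?_⟩
  have hT0 : 0 < T := by linarith
  rw [← integral_sub (integrable_twisted_zeta hφ hc h₀ (fun x hx => (hsupp x hx).1) hT hT₀ hf hα hβ)
    (integrable_twisted_smoothPoly hφ hc hT0 hf W _ _ α β)]
  set E := T / T ^ r * T + T ^ (8 * r) * (T / T ^ r') with hE
  have hE0 : 0 ≤ E := by positivity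
  have hbound : ∀ t : ℝ, ‖f (1 / 2 + t * I) * riemannZeta (1 / 2 + t * I + α) *
      riemannZeta (1 / 2 - t * I + β) * (φ (t / T) : ℂ) -
      f (1 / 2 + t * I) * smoothPoly W (T ^ (8 * r)) (1 / 2 + t * I + α) *
      smoothPoly W (T ^ (8 * r')) (1 / 2 - t * I + β) * (φ (t / T) : ℂ)‖ ≤
      ‖(φ (t / T) : ℂ)‖ * (D * ((C₁ * C₃ + 3 * C₂) * E)) := by
    intro t
    by_cases ht : φ (t / T) = 0
    · simp [ht]
    obtain ⟨ht0, ht1⟩ := hsupp _ ht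
    rw [div_le_iff₀ hT0] at ht1
    rw [le_div_iff₀ hT0] at ht0
    have e : (1 / 2 - t * I + β) = 1 / 2 + ((-1 * t : ℝ) : ℂ) * I + β := by push_cast; ring
    have e' : (1 / 2 + t * I + α) = 1 / 2 + ((1 * t : ℝ) : ℂ) * I + α := by push_cast; ring
    obtain ⟨b1, b2, b3, b4⟩ := shift_bounds h₀ hT hT₀ ht0 ht1 hα (σ := 1) (by norm_num)
    obtain ⟨d1, d2, d3, d4⟩ := shift_bounds h₀ hT hT₀ ht0 ht1 hβ (σ := -1) (by norm_num)
    rw [← e'] at b1 b2 b3 b4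
    rw [← e] at d1 d2 d3 d4
    have g1 := hz₁ T hT _ b1 b2 b3 b4
    have g2 := hz₂ T hT _ d1 d2 d3 d4
    have g3 := hz₃ T hT _ d1 d2 d3 d4
    have g4 : ‖smoothPoly W (T ^ (8 * r)) (1 / 2 + t * I + α)‖ ≤ 3 * T ^ (8 * r) :=
      norm_smoothPoly_le hW01 (by positivity) (by linarith)
    generalize riemannZeta (1 / 2 + t * I + α) = z₁ at *
    generalize riemannZeta (1 / 2 - t * I + β) = z₂ at *
    generalize smoothPoly W (T ^ (8 * r)) (1 / 2 + t * I + α) = d₁ at *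
    generalize smoothPoly W (T ^ (8 * r')) (1 / 2 - t * I + β) = d₂ at *
    -- The factors are replaced one after the other. The second error is multiplied by `d₁`, bounded
    -- only by `3 T^{8r}`, so `r'` will be chosen after `r`.
    have hid : f (1 / 2 + t * I) * z₁ * z₂ * (φ (t / T) : ℂ) -
        f (1 / 2 + t * I) * d₁ * d₂ * (φ (t / T) : ℂ) =
        (φ (t / T) : ℂ) * (f (1 / 2 + t * I) * ((z₁ - d₁) * z₂ + d₁ * (z₂ - d₂))) := by ring
    rw [hid, norm_mul, norm_mul]
    have hin : ‖(z₁ - d₁) * z₂ + d₁ * (z₂ - d₂)‖ ≤ (C₁ * C₃ + 3 * C₂) * E := by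
      refine (norm_add_le _ _).trans ?_
      rw [norm_mul, norm_mul]
      calc ‖z₁ - d₁‖ * ‖z₂‖ + ‖d₁‖ * ‖z₂ - d₂‖
          ≤ C₁ * (T / T ^ r) * (C₃ * T) + 3 * T ^ (8 * r) * (C₂ * (T / T ^ r')) := by gcongr
        _ = C₁ * C₃ * (T / T ^ r * T) + 3 * C₂ * (T ^ (8 * r) * (T / T ^ r')) := by ring
        _ ≤ C₁ * C₃ * E + 3 * C₂ * E := by
            have q1 : T / T ^ r * T ≤ E := le_add_of_nonneg_right (by positivity)
            have q2 : T ^ (8 * r) * (T / T ^ r') ≤ E := le_add_of_nonneg_left (by positivity)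
            gcongr
        _ = (C₁ * C₃ + 3 * C₂) * E := by ring
    gcongr
    exact hfD t
  refine (norm_integral_le_of_norm_le ((integrable_comp_div hφ hc hT0).norm.mul_const _)
    (Eventually.of_forall hbound)).trans (le_of_eq ?_)
  rw [integral_mul_const, integral_norm_comp_div φ hT0]
  ring

/-- Expanding the Dirichlet polynomials in the first variable. -/
lemma integral_dirichletPoly_mul_smoothPoly {φ : ℝ → ℝ} (hφ : Continuous φ)
    (hc : HasCompactSupport φ) {T : ℝ} (hT : 0 < T) (N : ℕ) (a : ℕ → ℂ) (W : ℝ → ℝ) (X Y : ℝ)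
    (α β : ℂ) :
    ∫ t : ℝ, dirichletPoly N a (1 / 2 + t * I) * smoothPoly W X (1 / 2 + t * I + α) *
      smoothPoly W Y (1 / 2 - t * I + β) * (φ (t / T) : ℂ) =
    ∑ n ∈ Finset.Icc 1 N, a n * ∑ k ∈ Finset.Icc 1 ⌊3 * X⌋₊,
      (W (k / X) : ℂ) * (k : ℂ) ^ (-α) * ∫ t : ℝ, (φ (t / T) : ℂ) *
        (((n * k : ℕ) : ℂ) ^ (-(1 / 2 + t * I)) * smoothPoly W Y (1 / 2 - t * I + β)) := by
  have hint : ∀ q : ℕ, q ≠ 0 → Integrable fun t : ℝ => (φ (t / T) : ℂ) *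
      ((q : ℂ) ^ (-(1 / 2 + t * I)) * smoothPoly W Y (1 / 2 - t * I + β)) := by
    intro q hq
    have h2 := continuous_smoothPoly W Y
    have h3 : Continuous fun t : ℝ => (q : ℂ) ^ (-(1 / 2 + t * I)) :=
      Continuous.const_cpow (by fun_prop) (Or.inl (Nat.cast_ne_zero.mpr hq))
    exact Continuous.integrable_of_hasCompactSupport (by fun_prop)
      (hasCompactSupport_comp_div hc hT).mul_right
  have hne : ∀ n ∈ Finset.Icc 1 N, ∀ k ∈ Finset.Icc 1 ⌊3 * X⌋₊, n * k ≠ 0 := by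
    intro n hn k hk
    rw [Finset.mem_Icc] at hn hk
    exact mul_ne_zero (by omega) (by omega)
  simp_rw [← integral_const_mul]
  have hstep : ∀ n ∈ Finset.Icc 1 N, (a n * ∑ k ∈ Finset.Icc 1 ⌊3 * X⌋₊, ∫ t : ℝ,
      (W (k / X) : ℂ) * (k : ℂ) ^ (-α) * ((φ (t / T) : ℂ) *
        (((n * k : ℕ) : ℂ) ^ (-(1 / 2 + t * I)) * smoothPoly W Y (1 / 2 - t * I + β)))) =
      ∫ t : ℝ, a n * ∑ k ∈ Finset.Icc 1 ⌊3 * X⌋₊, (W (k / X) : ℂ) * (k : ℂ) ^ (-α) *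
        ((φ (t / T) : ℂ) * (((n * k : ℕ) : ℂ) ^ (-(1 / 2 + t * I)) *
          smoothPoly W Y (1 / 2 - t * I + β))) := by
    intro n hn
    rw [integral_const_mul, integral_finsetSum _ fun k hk => (hint _ (hne n hn k hk)).const_mul _]
  rw [Finset.sum_congr rfl hstep, ← integral_finsetSum _ fun n hn => (integrable_finsetSum _
    fun k hk => (hint _ (hne n hn k hk)).const_mul _).const_mul _]
  congr 1; ext t
  have hX : smoothPoly W X (1 / 2 + t * I + α) = ∑ k ∈ Finset.Icc 1 ⌊3 * X⌋₊,
      (W (k / X) : ℂ) * ((k : ℂ) ^ (-α) * (k : ℂ) ^ (-(1 / 2 + t * I))) := by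
    refine Finset.sum_congr rfl fun k hk => ?_
    have hk0 : (k : ℂ) ≠ 0 := by
      have := (Finset.mem_Icc.mp hk).1
      exact Nat.cast_ne_zero.mpr (by omega)
    rw [← cpow_add _ _ hk0]
    congr 2; ring
  rw [hX, dirichletPoly, Finset.sum_mul, Finset.sum_mul, Finset.sum_mul]
  refine Finset.sum_congr rfl fun n _ => ?_
  rw [Finset.mul_sum, Finset.sum_mul, Finset.sum_mul, Finset.mul_sum]
  refine Finset.sum_congr rfl fun k _ => ?_
  rw [Nat.cast_mul, natCast_mul_natCast_cpow]
  ring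

/-! ### Bookkeeping of the error terms. -/

lemma summable_natCast_rpow_neg : Summable fun n : ℕ => (n : ℝ) ^ (-(3 / 2) : ℝ) :=
  Real.summable_nat_rpow.mpr (by norm_num)

lemma sum_sum_mul_rpow_le (N L : ℕ) :
    ∑ n ∈ Finset.Icc 1 N, ∑ k ∈ Finset.Icc 1 L, ((n * k : ℕ) : ℝ) ^ (-(3 / 2) : ℝ) ≤
      (∑' n : ℕ, (n : ℝ) ^ (-(3 / 2) : ℝ)) ^ 2 := by
  have h : ∀ M : ℕ, ∑ n ∈ Finset.Icc 1 M, (n : ℝ) ^ (-(3 / 2) : ℝ) ≤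
      ∑' n : ℕ, (n : ℝ) ^ (-(3 / 2) : ℝ) := fun M =>
    summable_natCast_rpow_neg.sum_le_tsum _ fun n _ => by positivity
  have he : ∑ n ∈ Finset.Icc 1 N, ∑ k ∈ Finset.Icc 1 L, ((n * k : ℕ) : ℝ) ^ (-(3 / 2) : ℝ) =
      (∑ n ∈ Finset.Icc 1 N, (n : ℝ) ^ (-(3 / 2) : ℝ)) *
        ∑ k ∈ Finset.Icc 1 L, (k : ℝ) ^ (-(3 / 2) : ℝ) := by
    rw [Finset.sum_mul_sum]
    refine Finset.sum_congr rfl fun n _ => Finset.sum_congr rfl fun k _ => ?_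
    rw [Nat.cast_mul, Real.mul_rpow (by positivity) (by positivity)]
  rw [he, sq]
  exact mul_le_mul (h N) (h L) (Finset.sum_nonneg fun n _ => by positivity)
    (tsum_nonneg fun n => by positivity)

lemma sum_sum_affine (N L : ℕ) (f : ℕ → ℕ → ℝ) (A M c U V Y : ℝ) :
    ∑ n ∈ Finset.Icc 1 N, A * ∑ k ∈ Finset.Icc 1 L, M * (c * (M * (U * f n k + V) + Y * V)) =
      A * (M * c * (M * U * (∑ n ∈ Finset.Icc 1 N, ∑ k ∈ Finset.Icc 1 L, f n k) +
        N * L * ((M + Y) * V))) := by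
  have hinner : ∀ n, A * ∑ k ∈ Finset.Icc 1 L, M * (c * (M * (U * f n k + V) + Y * V)) =
      A * (M * c * (M * U)) * (∑ k ∈ Finset.Icc 1 L, f n k) +
        A * (M * c * (L * ((M + Y) * V))) := by
    intro n
    have : ∀ k, M * (c * (M * (U * f n k + V) + Y * V)) =
        M * c * (M * U) * f n k + M * c * ((M + Y) * V) := fun k => by ring
    simp_rw [this]
    rw [Finset.sum_add_distrib, ← Finset.mul_sum, Finset.sum_const,
      Nat.card_Icc, nsmul_eq_mul, Nat.add_sub_cancel]
    ring
  simp_rw [hinner]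
  rw [Finset.sum_add_distrib, ← Finset.mul_sum, Finset.sum_const,
    Nat.card_Icc, nsmul_eq_mul, Nat.add_sub_cancel]
  ring

/-- The exponents are chosen so that, after `N` and `A` are replaced by their bounds, every power of
`T` cancels and each of the two terms is exactly `c`. -/
lemma truncation_error_le {T N A c : ℝ} {P : ℕ} (hT : 0 < T) (hNP : N ≤ T ^ P)
    (hA : 0 ≤ A) (hAP : A ≤ c * T ^ P) :
    N * A * T * (T / T ^ (2 * P + 3) * T + T ^ (8 * (2 * P + 3)) *
      (T / T ^ (2 * P + 8 * (2 * P + 3) + 2))) ≤ 2 * c := by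
  calc _ ≤ T ^ P * (c * T ^ P) * T * (T / T ^ (2 * P + 3) * T + T ^ (8 * (2 * P + 3)) *
        (T / T ^ (2 * P + 8 * (2 * P + 3) + 2))) := by gcongr
    _ = 2 * c := by
        rw [pow_add T (2 * P + 8 * (2 * P + 3)) 2, pow_add T (2 * P) (8 * (2 * P + 3)),
          pow_add T (2 * P) 3, show 2 * P = P + P by ring, pow_add T P P]
        field_simp
        ring

/-- The choice of `J` cancels the lengths of all the sums in the negligible part. The rest is
`T^{ε/2}` from the coefficients times `T^{1/2+ε/2}` from the dual terms. -/
lemma dual_error_le {T ε c M c' N L X Y S Z : ℝ} {P J : ℕ} (hT : 1 ≤ T) (hε : 0 ≤ ε) (hc : 0 ≤ c)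
    (hM : 0 ≤ M) (hc' : 0 ≤ c') (hNP : N ≤ T ^ P) (hL : 0 ≤ L) (hLX : L ≤ 3 * X)
    (hY : 1 ≤ Y) (hS : S ≤ Z ^ 2) (hJ : X * Y * T ^ P * T = T ^ J) :
    c * T ^ (ε / 2) * (M * c' * (M * T ^ (1 / 2 + ε / 2) * S + N * L * ((M + Y) * (T / T ^ J)))) ≤
      c * (M * c' * (M * Z ^ 2 + 3 * (M + 1))) * T ^ (1 / 2 + ε) := by
  have hT0 : 0 < T := by linarith
  have hX : 0 ≤ X := by linarith
  have htail : N * L * ((M + Y) * (T / T ^ J)) ≤ 3 * (M + 1) := by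
    have hMY : M + Y ≤ (M + 1) * Y := by nlinarith
    calc N * L * ((M + Y) * (T / T ^ J)) ≤ T ^ P * (3 * X) * ((M + 1) * Y * (T / T ^ J)) := by
          gcongr
      _ = 3 * (M + 1) * (X * Y * T ^ P * T) / T ^ J := by ring
      _ = 3 * (M + 1) := by
          rw [hJ]
          field_simp
  have hone : 3 * (M + 1) ≤ 3 * (M + 1) * T ^ (1 / 2 + ε / 2) :=
    le_mul_of_one_le_right (by positivity) (Real.one_le_rpow hT (by linarith))
  calc _ ≤ c * T ^ (ε / 2) * (M * c' * (M * T ^ (1 / 2 + ε / 2) * Z ^ 2 + 3 * (M + 1))) := by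
        gcongr
    _ ≤ c * T ^ (ε / 2) * (M * c' * (M * T ^ (1 / 2 + ε / 2) * Z ^ 2 +
        3 * (M + 1) * T ^ (1 / 2 + ε / 2))) := by
        exact mul_le_mul_of_nonneg_left (mul_le_mul_of_nonneg_left (by linarith)
          (by positivity)) (by positivity)
    _ = c * (M * c' * (M * Z ^ 2 + 3 * (M + 1))) * (T ^ (ε / 2) * T ^ (1 / 2 + ε / 2)) := by ring
    _ = _ := by
        rw [← Real.rpow_add hT0]
        congr 2; ring

end TwistedMoment

/-! ### Assembly of the asymptotic formula. -/

open TwistedMoment in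
theorem proposition1
    (φ : ℝ → ℝ) (hφ_smooth : ContDiff ℝ (⊤ : ℕ∞) φ) (hφ_compact : HasCompactSupport φ)
    (hφ_pos : tsupport φ ⊆ Set.Ioi (0 : ℝ))
    (θ : ℝ) (hθ : 0 < θ) (C : ℝ → ℝ) (K : ℝ) (ε : ℝ) (hε : 0 < ε) :
    ∃ B T₀ : ℝ, 1 < T₀ ∧ ∀ T : ℝ, T₀ ≤ T →
      ∀ (N : ℕ) (a : ℕ → ℂ), (N : ℝ) ≤ T ^ θ →
        (∀ η : ℝ, 0 < η → ∀ n ∈ Finset.Icc 1 N, ‖a n‖ ≤ C η * (n : ℝ) ^ η) →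
      ∀ α β : ℂ, ‖α‖ ≤ K / Real.log T → ‖β‖ ≤ K / Real.log T →
        ‖(∫ t : ℝ, TwistedMoment.dirichletPoly N a (1 / 2 + (t : ℂ) * Complex.I) *
              riemannZeta (1 / 2 + (t : ℂ) * Complex.I + α) *
              riemannZeta (1 / 2 - (t : ℂ) * Complex.I + β) * (φ (t / T) : ℂ)) -
            (T : ℂ) * ∑ n ∈ Finset.Icc 1 N, a n / (n : ℂ) ^ (1 + β) *
              TwistedMoment.kernelF φ ((α + β) / 2) (T / (2 * Real.pi * (n : ℝ)))‖
          ≤ B * T ^ (1 / 2 + ε) := by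
  obtain ⟨W, hW01, hW1, hWz⟩ := exists_smooth_zeta_approx
  obtain ⟨c₀, c₁, h₀, h₁, hsupp⟩ := exists_support_bounds hφ_compact hφ_pos
  obtain ⟨P, hP⟩ := exists_nat_ge (max θ (ε / 2))
  have hPθ : θ ≤ P := (le_max_left _ _).trans hP
  have hPε : ε / 2 ≤ P := (le_max_right _ _).trans hP
  obtain ⟨r, hr⟩ : ∃ r, r = 2 * P + 3 := ⟨_, rfl⟩
  obtain ⟨r', hr'⟩ : ∃ r', r' = 2 * P + 8 * r + 2 := ⟨_, rfl⟩
  obtain ⟨J, hJ⟩ : ∃ J, J = P + 8 * r + 8 * r' + 1 := ⟨_, rfl⟩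
  obtain ⟨C₁, hC₁, hzeta⟩ := exists_norm_integral_zeta_sub_smoothPoly_le hφ_smooth.continuous
    hφ_compact hW01 hWz h₀ h₁ hsupp r r'
  obtain ⟨C₂, T₁, hC₂, hfreq⟩ := exists_norm_integral_smoothPoly_sub_le hφ_smooth hφ_compact
    hφ_pos hW01 hW1 (half_pos hε) J
  set M : ℝ := Real.exp (|K| * (2 + (P + 8 * r : ℕ))) with hM
  have hM0 : 0 < M := Real.exp_pos _
  set Z : ℝ := ∑' n : ℕ, (n : ℝ) ^ (-(3 / 2) : ℝ) with hZ
  set C₀ : ℝ := |C (ε / (2 * θ))| with hC₀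
  refine ⟨C₁ * (2 * C₀) + C₀ * (M * C₂ * (M * Z ^ 2 + 3 * (M + 1))),
    -- The summand `9` absorbs the factor `3 * 3` in `hthree` and gives `log T ≥ 1`; `e^{4|K|}`
    -- makes both shifts at most `1/4`; `c₁` gives `c₁ T ≤ T²`.
    9 + c₁ + 1 / c₀ + |T₁| + Real.exp (4 * |K|), ?_, ?_⟩
  · have : 0 < 1 / c₀ := by positivity
    linarith [abs_nonneg T₁, Real.exp_pos (4 * |K|)]
  intro T hT N a hN ha α β hα hβ
  have hc0inv : 0 < 1 / c₀ := by positivity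
  have hT9 : 9 ≤ T := by linarith [abs_nonneg T₁, Real.exp_pos (4 * |K|)]
  have hTc₁ : c₁ ≤ T := by linarith [abs_nonneg T₁, Real.exp_pos (4 * |K|)]
  have hTc₀ : 1 / c₀ ≤ T := by linarith [abs_nonneg T₁, Real.exp_pos (4 * |K|)]
  have hTT₁ : T₁ ≤ T := by linarith [le_abs_self T₁, Real.exp_pos (4 * |K|)]
  have hTK : Real.exp (4 * |K|) ≤ T := by linarith [abs_nonneg T₁]
  have hT1 : 1 ≤ T := by linarith
  have hT0 : 0 < T := by linarith
  have hlog1 : 1 ≤ Real.log T := by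
    rw [Real.le_log_iff_exp_le hT0]
    linarith [Real.exp_one_lt_d9]
  have hlogK : 4 * |K| ≤ Real.log T := by rwa [Real.le_log_iff_exp_le hT0]
  have hsmall : K / Real.log T ≤ 1 / 4 := by
    rw [div_le_iff₀ (by linarith)]
    linarith [le_abs_self K]
  have hα' : ‖α‖ ≤ 1 / 4 := hα.trans hsmall
  have hβ' : ‖β‖ ≤ 1 / 4 := hβ.trans hsmall
  have hC₀0 : 0 ≤ C₀ := abs_nonneg _
  set A : ℝ := C₀ * T ^ (ε / 2) with hA
  have hA0 : 0 ≤ A := by positivity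
  have haA : ∀ n ∈ Finset.Icc 1 N, ‖a n‖ ≤ A := by
    intro n hn
    -- The choice `η = ε / (2θ)` turns `n ≤ T^θ` into `n^η ≤ T^{ε/2}`.
    refine (ha (ε / (2 * θ)) (by positivity) n hn).trans ?_
    have hnN : (n : ℝ) ≤ T ^ θ :=
      le_trans (by exact_mod_cast (Finset.mem_Icc.mp hn).2) hN
    calc C (ε / (2 * θ)) * (n : ℝ) ^ (ε / (2 * θ)) ≤ C₀ * (T ^ θ) ^ (ε / (2 * θ)) := by
          gcongr
          exact le_abs_self _
      _ = A := by
          rw [hA, ← Real.rpow_mul hT0.le]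
          congr 2
          field_simp
  have hNP : (N : ℝ) ≤ T ^ P := by
    refine hN.trans ?_
    rw [← Real.rpow_natCast]
    exact Real.rpow_le_rpow_of_exponent_le hT1 hPθ
  have hAP : A ≤ C₀ * T ^ P := by
    rw [hA, ← Real.rpow_natCast T P]
    gcongr
  set X : ℝ := T ^ (8 * r) with hX
  set Y : ℝ := T ^ (8 * r') with hY
  have hX0 : 0 < X := by positivity
  have hY0 : 0 < Y := by positivity
  have hY1 : 1 ≤ Y := one_le_pow₀ hT1
  have hTX : c₁ * T ≤ X := by
    calc c₁ * T ≤ T * T := by gcongr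
      _ = T ^ 2 := (sq T).symm
      _ ≤ X := pow_le_pow_right₀ hT1 (by omega)
  have hTbig : 1 ≤ T ^ (1 / 2 + ε) := Real.one_le_rpow hT1 (by linarith)
  -- Every frequency `q = nk` is at most `3 T^{P+8r}`, so the second polynomial extends beyond `3q`,
  -- as the exchange of weights requires.
  have hthree : 3 * (3 * T ^ (P + 8 * r)) ≤ Y := by
    calc 3 * (3 * T ^ (P + 8 * r)) ≤ T * T ^ (P + 8 * r) := by
          rw [← mul_assoc]; gcongr; linarith
      _ = T ^ (P + 8 * r + 1) := by ring
      _ ≤ Y := pow_le_pow_right₀ hT1 (by omega)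
  set L := ⌊3 * X⌋₊ with hL
  have hLX : (L : ℝ) ≤ 3 * X := Nat.floor_le (by positivity)
  have hqle : ∀ n ∈ Finset.Icc 1 N, ∀ k ∈ Finset.Icc 1 L,
      1 ≤ n * k ∧ ((n * k : ℕ) : ℝ) ≤ 3 * T ^ (P + 8 * r) := by
    intro n hn k hk
    rw [Finset.mem_Icc] at hn hk
    refine ⟨Nat.mul_pos hn.1 hk.1, ?_⟩
    have hn' : (n : ℝ) ≤ T ^ P := le_trans (by exact_mod_cast hn.2) hNP
    have hk' : (k : ℝ) ≤ 3 * X := le_trans (by exact_mod_cast hk.2) hLX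
    calc ((n * k : ℕ) : ℝ) = n * k := by push_cast; ring
      _ ≤ T ^ P * (3 * X) := by gcongr
      _ = 3 * T ^ (P + 8 * r) := by rw [hX, pow_add]; ring
  have hkle : ∀ n ∈ Finset.Icc 1 N, ∀ k ∈ Finset.Icc 1 L, (k : ℝ) ≤ 3 * T ^ (P + 8 * r) := by
    intro n hn k hk
    refine le_trans ?_ (hqle n hn k hk).2
    rw [Finset.mem_Icc] at hn
    exact_mod_cast Nat.le_mul_of_pos_left k hn.1
  have hstep1 := hzeta T hT1 hTc₀ (dirichletPoly N a) (continuous_dirichletPoly N a)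
    (N * A) (by positivity) (fun t => norm_dirichletPoly_le haA (by simp)) α β hα' hβ'
  have hstep1' : C₁ * (N * A * T * (T / T ^ r * T + T ^ (8 * r) * (T / T ^ r'))) ≤
      C₁ * (2 * C₀) * T ^ (1 / 2 + ε) := by
    have hle : N * A * T * (T / T ^ r * T + T ^ (8 * r) * (T / T ^ r')) ≤ 2 * C₀ := by
      rw [hr', hr]
      exact truncation_error_le hT0 hNP hA0 hAP
    calc _ ≤ C₁ * (2 * C₀) := by gcongr
      _ ≤ C₁ * (2 * C₀) * T ^ (1 / 2 + ε) := le_mul_of_one_le_right (by positivity) hTbig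
  have hmain : (T : ℂ) * ∑ n ∈ Finset.Icc 1 N, a n / (n : ℂ) ^ (1 + β) *
      kernelF φ ((α + β) / 2) (T / (2 * Real.pi * (n : ℝ))) =
      ∑ n ∈ Finset.Icc 1 N, a n * ∑ k ∈ Finset.Icc 1 L, (W (k / X) : ℂ) * (k : ℂ) ^ (-α) *
        (((n * k : ℕ) : ℂ) ^ (-β) *
        (2 * Real.pi * ∑' j : ℕ, (φ (2 * Real.pi * (n * k : ℕ) * (j + 1) / T) : ℂ))) := by
    rw [Finset.mul_sum]
    refine Finset.sum_congr rfl fun n hn => ?_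
    rw [← kernelF_mul_eq_sum hφ_smooth hφ_compact hφ_pos hW1 (fun x hx => (hsupp x hx).2) hT0 hX0
      hTX hα' hβ' (Finset.mem_Icc.mp hn).1]
    ring
  have hstep2 : ‖(∫ t : ℝ, dirichletPoly N a (1 / 2 + t * Complex.I) *
        smoothPoly W X (1 / 2 + t * Complex.I + α) *
        smoothPoly W Y (1 / 2 - t * Complex.I + β) * (φ (t / T) : ℂ)) -
      (T : ℂ) * ∑ n ∈ Finset.Icc 1 N, a n / (n : ℂ) ^ (1 + β) *
        kernelF φ ((α + β) / 2) (T / (2 * Real.pi * (n : ℝ)))‖ ≤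
      ∑ n ∈ Finset.Icc 1 N, A * ∑ k ∈ Finset.Icc 1 L, M * (C₂ * (M * (T ^ (1 / 2 + ε / 2) *
        ((n * k : ℕ) : ℝ) ^ (-(3 / 2) : ℝ) + T / T ^ J) + Y * (T / T ^ J))) := by
    rw [hmain, integral_dirichletPoly_mul_smoothPoly hφ_smooth.continuous hφ_compact hT0,
      ← Finset.sum_sub_distrib]
    refine norm_sum_le_of_le _ fun n hn => ?_
    rw [← mul_sub, ← Finset.sum_sub_distrib, norm_mul]
    refine mul_le_mul (haA n hn) ?_ (norm_nonneg _) hA0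
    refine norm_sum_le_of_le _ fun k hk => ?_
    obtain ⟨hq1, hq2⟩ := hqle n hn k hk
    rw [← mul_sub, norm_mul, norm_mul, Complex.norm_real, Real.norm_of_nonneg (hW01 _).1]
    have hkM : ‖(k : ℂ) ^ (-α)‖ ≤ M :=
      norm_natCast_cpow_neg_le_exp hlog1 hT0 hα (Finset.mem_Icc.mp hk).1 (hkle n hn k hk)
    have hqM : ‖((n * k : ℕ) : ℂ) ^ (-β)‖ ≤ M :=
      norm_natCast_cpow_neg_le_exp hlog1 hT0 hβ hq1 hq2
    refine mul_le_mul ?_ ?_ (norm_nonneg _) hM0.le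
    · exact (mul_le_of_le_one_left (norm_nonneg _) (hW01 _).2).trans hkM
    · refine (hfreq β hβ' T hT1 hTT₁ (n * k) hq1 Y (le_trans (by linarith) hthree)).trans ?_
      gcongr
  have hsum : ∑ n ∈ Finset.Icc 1 N, A * ∑ k ∈ Finset.Icc 1 L, M * (C₂ * (M * (T ^ (1 / 2 + ε / 2) *
        ((n * k : ℕ) : ℝ) ^ (-(3 / 2) : ℝ) + T / T ^ J) + Y * (T / T ^ J))) =
      A * (M * C₂ * (M * T ^ (1 / 2 + ε / 2) * (∑ n ∈ Finset.Icc 1 N, ∑ k ∈ Finset.Icc 1 L,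
        ((n * k : ℕ) : ℝ) ^ (-(3 / 2) : ℝ)) + N * L * ((M + Y) * (T / T ^ J)))) := sum_sum_affine N L _ A M C₂ _ _ Y
  have hstep2' := dual_error_le hT1 hε.le hC₀0 hM0.le hC₂ hNP
    (Nat.cast_nonneg L) hLX hY1 (sum_sum_mul_rpow_le N L)
    (by rw [hJ, hX, hY]; ring : X * Y * T ^ P * T = T ^ J)
  refine (norm_sub_le_norm_sub_add_norm_sub _ (∫ t : ℝ, dirichletPoly N a (1 / 2 + t * Complex.I) *
    smoothPoly W X (1 / 2 + t * Complex.I + α) *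
    smoothPoly W Y (1 / 2 - t * Complex.I + β) * (φ (t / T) : ℂ)) _).trans ?_
  rw [add_mul]
  exact add_le_add (hstep1.trans hstep1') (hstep2.trans ((le_of_eq hsum).trans hstep2'))
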